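/- Let $(M,g)$ be a nonempty compact smooth Riemannian manifold of dimension $n\ge 2$, possibly with boundary, with Riemannian volume measure $v_g$ and total volume $|M|_g$. For positive continuous functions $\rho,\sigma$ on $M$ and an integer $k\ge 0$ put $$\mu_k(\rho,\sigma)=\inf_{E\in S_{k+1}}\ \sup_{u\in E\setminus\{0\}}\frac{\int_M|\nabla u|^2\,\sigma\,v_g}{\int_M u^2\,\rho\,v_g},$$ where $S_{k+1}$ is the set of all $(k+1)$-dimensional vector subspaces of the Sobolev space $H^1(M)$. Let $\mathcal R_0$ be the set of positive smooth functions $\phi$ on $M$ with $\frac1{|M|_g}\int_M\phi\,v_g=1$. Then for every integer $k\ge 1$ and every real $p>0$, $$\text{(i)}\ \inf_{\rho\in\mathcal R_0}\mu_k(\rho,1)=0,\qquad \text{(ii)}\ \inf_{\sigma\in\mathcal R_0}\mu_k(1,\sigma)=0,\qquad \text{(iii)}\ \inf_{\rho\in\mathcal R_0}\mu_k(\rho,\rho^p)=0.$$ -/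

import Mathlib

open MeasureTheory Set
open scoped Manifold ContDiff ENNReal

noncomputable section

namespace WeightedLaplacian

variable {n : ℕ} {H : Type*} [TopologicalSpace H]
  {I : ModelWithCorners ℝ (EuclideanSpace ℝ (Fin n)) H}
  {M : Type*} [TopologicalSpace M] [ChartedSpace H M]

/-- The inverse of the chart around `α` sends the vector `v`, based at the point `y` of the chart
domain in `ℝⁿ`, to the tangent vector `∑ i, vⁱ ∂/∂yⁱ` of `M`. -/
def coordVector (I : ModelWithCorners ℝ (EuclideanSpace ℝ (Fin n)) H) (α : M)
    (y : EuclideanSpace ℝ (Fin n)) (v : EuclideanSpace ℝ (Fin n)) :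
    TangentSpace I ((extChartAt I α).symm y) :=
  mfderivWithin 𝓘(ℝ, EuclideanSpace ℝ (Fin n)) I (extChartAt I α).symm (range I) y v

variable [IsManifold I ∞ M]

/-- The coefficients `g_ij = g(∂_i, ∂_j)` of the Riemannian metric in the chart around `α`. -/
def metricMatrix (g : Bundle.ContMDiffRiemannianMetric I ∞ (EuclideanSpace ℝ (Fin n))
      (fun x : M ↦ TangentSpace I x)) (α : M) (y : EuclideanSpace ℝ (Fin n)) :
    Matrix (Fin n) (Fin n) ℝ :=
  Matrix.of fun i j ↦ g.inner ((extChartAt I α).symm y)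
    (coordVector I α y (EuclideanSpace.single i 1)) (coordVector I α y (EuclideanSpace.single j 1))

/-- The vector field `X` is the weak gradient of `u`: in the interior of each chart
(with Lebesgue measure `dy`), for each vector `v` and each test function `ψ`,
`∫ u ∂_v ψ dy = - ∫ g(X, v) ψ dy`, that is, the weak differential of `u` is `g(X, ·)`. -/
structure HasWeakGradient (g : Bundle.ContMDiffRiemannianMetric I ∞ (EuclideanSpace ℝ (Fin n))
      (fun x : M ↦ TangentSpace I x)) (u : M → ℝ) (X : (x : M) → TangentSpace I x) : Prop where
  locallyIntegrableOn (α : M) :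
    LocallyIntegrableOn (fun y ↦ u ((extChartAt I α).symm y)) (interior (extChartAt I α).target)
  locallyIntegrableOn_inner (α : M) (v : EuclideanSpace ℝ (Fin n)) :
    LocallyIntegrableOn (fun y ↦ g.inner ((extChartAt I α).symm y)
      (X ((extChartAt I α).symm y)) (coordVector I α y v)) (interior (extChartAt I α).target)
  integral_eq (α : M) (v : EuclideanSpace ℝ (Fin n)) (ψ : EuclideanSpace ℝ (Fin n) → ℝ)
    (smooth : ContDiff ℝ ∞ ψ) (compact : HasCompactSupport ψ)
    (support : tsupport ψ ⊆ interior (extChartAt I α).target) :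
    ∫ y, u ((extChartAt I α).symm y) * fderiv ℝ ψ y v =
      - ∫ y, g.inner ((extChartAt I α).symm y)
          (X ((extChartAt I α).symm y)) (coordVector I α y v) * ψ y

variable [MeasurableSpace M]

/-- The Riemannian volume of the domain of the chart around `α`, as a measure on `M`: the measure
`√(det g_ij) dy` on the image of the chart, carried over to `M`. -/
def chartVolume (g : Bundle.ContMDiffRiemannianMetric I ∞ (EuclideanSpace ℝ (Fin n))
      (fun x : M ↦ TangentSpace I x)) (α : M) : Measure M :=
  ((volume.restrict (extChartAt I α).target).withDensity
    (fun y ↦ ENNReal.ofReal √(metricMatrix g α y).det)).map (extChartAt I α).symm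

/-- The Riemannian volume measure `v_g`. The measures `chartVolume g α` coincide on the
intersections of chart domains, so their supremum (in the lattice of measures) is the measure on
`M` that restricts to `√(det g_ij) dy` on every chart domain. -/
def riemannianVolume (g : Bundle.ContMDiffRiemannianMetric I ∞ (EuclideanSpace ℝ (Fin n))
      (fun x : M ↦ TangentSpace I x)) : Measure M :=
  ⨆ α : M, chartVolume g α

/-- Membership in the Sobolev space `H¹(M)`: an `L²` function with a weak gradient in `L²`. -/
def MemH1 (g : Bundle.ContMDiffRiemannianMetric I ∞ (EuclideanSpace ℝ (Fin n))
      (fun x : M ↦ TangentSpace I x)) (u : Lp ℝ 2 (riemannianVolume g)) : Prop :=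
  ∃ X : (x : M) → TangentSpace I x, HasWeakGradient g u X ∧
    ∫⁻ x, ENNReal.ofReal (g.inner x (X x) (X x)) ∂riemannianVolume g < ⊤

/-- The weighted Dirichlet energy `∫ |∇u|² σ v_g`. The weak gradient is unique up to null sets, so
the infimum is over a single value if `u` has a weak gradient (and it is `∞` otherwise). -/
def dirichletEnergy (g : Bundle.ContMDiffRiemannianMetric I ∞ (EuclideanSpace ℝ (Fin n))
      (fun x : M ↦ TangentSpace I x)) (σ : M → ℝ) (u : Lp ℝ 2 (riemannianVolume g)) : ℝ≥0∞ :=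
  ⨅ (X : (x : M) → TangentSpace I x) (_ : HasWeakGradient g u X),
    ∫⁻ x, ENNReal.ofReal (g.inner x (X x) (X x) * σ x) ∂riemannianVolume g

/-- The Rayleigh quotient `∫ |∇u|² σ v_g / ∫ u² ρ v_g`. -/
def rayleighQuotient (g : Bundle.ContMDiffRiemannianMetric I ∞ (EuclideanSpace ℝ (Fin n))
      (fun x : M ↦ TangentSpace I x)) (ρ σ : M → ℝ) (u : Lp ℝ 2 (riemannianVolume g)) : ℝ≥0∞ :=
  dirichletEnergy g σ u / ∫⁻ x, ENNReal.ofReal (u x ^ 2 * ρ x) ∂riemannianVolume g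

/-- The eigenvalue `μ_k(ρ, σ)`: the infimum over the `(k + 1)`-dimensional subspaces `W` of `H¹(M)`
of the supremum of the Rayleigh quotient over `W \ {0}`. -/
def eigenvalue (g : Bundle.ContMDiffRiemannianMetric I ∞ (EuclideanSpace ℝ (Fin n))
      (fun x : M ↦ TangentSpace I x)) (k : ℕ) (ρ σ : M → ℝ) : ℝ≥0∞ :=
  ⨅ (W : Submodule ℝ (Lp ℝ 2 (riemannianVolume g)))
    (_ : (∀ u ∈ W, MemH1 g u) ∧ Module.finrank ℝ W = k + 1),
    ⨆ (u : Lp ℝ 2 (riemannianVolume g)) (_ : u ∈ W ∧ u ≠ 0), rayleighQuotient g ρ σ u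

/-- The smooth positive densities on `M` with mean value `1`. -/
def normalizedDensities (g : Bundle.ContMDiffRiemannianMetric I ∞ (EuclideanSpace ℝ (Fin n))
      (fun x : M ↦ TangentSpace I x)) : Set (M → ℝ) :=
  {φ | ContMDiff I 𝓘(ℝ, ℝ) ∞ φ ∧ (∀ x, 0 < φ x) ∧ ⨍ x, φ x ∂riemannianVolume g = 1}

end WeightedLaplacian

end

/-!
The point is that a density may be concentrated where the test functions are constant, so that their
energy only sees a region where the density is small.

Inside one chart choose `k + 1` disjoint closed balls. On each ball take a smooth cutoff function
`u i` supported there and equal to `1` near the centre, and a smooth density `q i` of mass one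
supported where `u i = 1`. The span of the `u i` is a `(k + 1)`-dimensional subspace of `H¹(M)`. By
disjointness of the supports its Rayleigh quotients are at most the largest of those of the `u i`
(`eigenvalue_le_of_disjoint_tsupport`). Put `ρ_δ = (δ + ∑ q i) / A_δ`, where `A_δ` is the constant
that makes the mean value one; it stays bounded, and bounded away from zero, as `δ → 0`. Then
`∫ u i ^ 2 ρ_δ ≥ 1 / A_δ`, while `ρ_δ = δ / A_δ` wherever some `∇ u i` does not vanish. Hence
`μ_k(ρ_δ, ρ_δ ^ p) ≤ (δ / A_δ) ^ p A_δ max ∫ |∇ u i|²` for all real `p`, and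
`μ_k(1, ρ_δ) ≤ C δ / A_δ`. Letting `δ → 0` gives the second and third claims. For the first one take
`p = 0` and `δ = 1`: here the energies of the `u i` themselves have to be small, which is possible
because points have zero capacity in dimension at least two
(`exists_cutoff_integral_sq_norm_fderiv_le`). The functions and densities are packaged in
`IsPlateauSystem`.

The remaining work consists of basic facts on the objects involved. The chart volumes agree on
overlaps by the change of variables formula (`riemannianVolume_eq_chartVolume`), so the Riemannian
volume of a compact manifold is finite, and without this `normalizedDensities` would be empty.
Smooth functions have a weak gradient, namely their Riemannian gradient
(`hasWeakGradient_gradient`). Only upper bounds of the Dirichlet energy are needed, so uniqueness of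
weak gradients plays no role.
-/

set_option linter.unusedSectionVars false

noncomputable section

namespace WeightedLaplacian

open Bundle Filter Topology

/-! ### The metric in a chart -/

section

set_option synthInstance.maxHeartbeats 200000 in
lemma continuousOn_inCoordinates_of_continuous {B F : Type*} {E : B → Type*}
    [TopologicalSpace B] [NormedAddCommGroup F] [NormedSpace ℝ F]
    [TopologicalSpace (TotalSpace F E)] [∀ x, TopologicalSpace (E x)] [∀ x, AddCommGroup (E x)]
    [∀ x, Module ℝ (E x)] [∀ x, IsTopologicalAddGroup (E x)] [∀ x, ContinuousSMul ℝ (E x)]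
    [FiberBundle F E] [VectorBundle ℝ F E] (g : ∀ x, E x →L[ℝ] E x →L[ℝ] ℝ)
    (hg : Continuous fun b ↦ TotalSpace.mk' (F →L[ℝ] F →L[ℝ] ℝ) b (g b)) (α : B) :
    ContinuousOn (fun x ↦ ContinuousLinearMap.inCoordinates F E (F →L[ℝ] ℝ)
      (fun x ↦ E x →L[ℝ] ℝ) α x α x (g x)) (trivializationAt F E α).baseSet := by
  intro x hx
  let e := trivializationAt (F →L[ℝ] F →L[ℝ] ℝ) (fun x ↦ E x →L[ℝ] E x →L[ℝ] ℝ) α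
  have h'x : TotalSpace.mk' (F →L[ℝ] F →L[ℝ] ℝ) x (g x) ∈ e.source := by
    rw [e.mem_source]
    simpa [e, hom_trivializationAt_baseSet] using hx
  have := (e.continuousAt h'x).comp
    (f := fun b ↦ TotalSpace.mk' (F →L[ℝ] F →L[ℝ] ℝ) b (g b)) hg.continuousAt
  exact (continuous_snd.continuousAt.comp this).continuousWithinAt

variable {n : ℕ} {H : Type*} [TopologicalSpace H]
  {I : ModelWithCorners ℝ (EuclideanSpace ℝ (Fin n)) H}
  {M : Type*} [TopologicalSpace M] [ChartedSpace H M] [IsManifold I ∞ M]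

/-- The metric at `x`, read in the trivialization of the tangent bundle given by the chart
around `α`, as a bilinear form on `ℝⁿ`. It is meaningful for `x` in the domain of that chart. -/
def chartMetric (g : ContMDiffRiemannianMetric I ∞ (EuclideanSpace ℝ (Fin n))
      (fun x : M ↦ TangentSpace I x)) (α x : M) :
    EuclideanSpace ℝ (Fin n) →L[ℝ] EuclideanSpace ℝ (Fin n) →L[ℝ] ℝ :=
  ContinuousLinearMap.inCoordinates (EuclideanSpace ℝ (Fin n)) (fun x : M ↦ TangentSpace I x)
    (EuclideanSpace ℝ (Fin n) →L[ℝ] ℝ) (fun x : M ↦ TangentSpace I x →L[ℝ] ℝ) α x α x (g.inner x)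

variable (g : ContMDiffRiemannianMetric I ∞ (EuclideanSpace ℝ (Fin n))
      (fun x : M ↦ TangentSpace I x))

lemma chartMetric_apply {α x : M} (hx : x ∈ (chartAt H α).source)
    (v w : EuclideanSpace ℝ (Fin n)) :
    chartMetric g α x v w =
      g.inner x ((trivializationAt (EuclideanSpace ℝ (Fin n)) (TangentSpace I) α).symmL ℝ x v)
        ((trivializationAt (EuclideanSpace ℝ (Fin n)) (TangentSpace I) α).symmL ℝ x w) := by
  have h'x : x ∈ (trivializationAt (EuclideanSpace ℝ (Fin n))
    (TangentSpace I : M → Type _) α).baseSet := by simpa using hx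
  rw [chartMetric, inCoordinates_apply_eq₂ h'x h'x (Set.mem_univ _)]
  simp only [Trivial.fiberBundle_trivializationAt', Trivial.linearMapAt_trivialization,
    LinearMap.id_coe, id_eq]
  exact congrArg₂ (fun a b ↦ g.inner x a b) (Trivialization.symmL_apply _ h'x v).symm
    (Trivialization.symmL_apply _ h'x w).symm

lemma continuousOn_chartMetric (α : M) :
    ContinuousOn (chartMetric g α) (chartAt H α).source := by
  have := continuousOn_inCoordinates_of_continuous g.inner g.contMDiff.continuous α
  rwa [TangentBundle.trivializationAt_baseSet] at this

/-- The coordinate vectors of a chart are the inverse of the trivialization that it induces. -/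
lemma coordVector_eq_symmL {α : M} {y : EuclideanSpace ℝ (Fin n)}
    (hy : y ∈ (extChartAt I α).target) (v : EuclideanSpace ℝ (Fin n)) :
    coordVector I α y v = (trivializationAt (EuclideanSpace ℝ (Fin n)) (TangentSpace I) α).symmL ℝ
      ((extChartAt I α).symm y) v := by
  have hx : (extChartAt I α).symm y ∈ (chartAt H α).source := by
    rw [← extChartAt_source I]; exact (extChartAt I α).map_target hy
  rw [TangentBundle.symmL_trivializationAt hx]
  exact congrArg (fun z ↦ (mfderivWithin 𝓘(ℝ, EuclideanSpace ℝ (Fin n)) I (extChartAt I α).symm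
    (range I) z : EuclideanSpace ℝ (Fin n) →L[ℝ] EuclideanSpace ℝ (Fin n)) v)
    ((extChartAt I α).right_inv hy).symm

lemma inner_coordVector {α : M} {y : EuclideanSpace ℝ (Fin n)}
    (hy : y ∈ (extChartAt I α).target) (v w : EuclideanSpace ℝ (Fin n)) :
    g.inner ((extChartAt I α).symm y) (coordVector I α y v) (coordVector I α y w) =
      chartMetric g α ((extChartAt I α).symm y) v w := by
  have hx : (extChartAt I α).symm y ∈ (chartAt H α).source := by
    rw [← extChartAt_source I]; exact (extChartAt I α).map_target hy
  rw [chartMetric_apply g hx, coordVector_eq_symmL hy, coordVector_eq_symmL hy]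

lemma chartMetric_pos {α x : M} (hx : x ∈ (chartAt H α).source) {v : EuclideanSpace ℝ (Fin n)}
    (hv : v ≠ 0) : 0 < chartMetric g α x v v := by
  have h'x : x ∈ (trivializationAt (EuclideanSpace ℝ (Fin n))
    (TangentSpace I : M → Type _) α).baseSet := by simpa using hx
  rw [chartMetric_apply g hx]
  refine g.pos _ _ fun h ↦ hv ?_
  rw [← ContinuousLinearMap.map_zero
    ((trivializationAt (EuclideanSpace ℝ (Fin n)) (TangentSpace I) α).symmL ℝ x)] at h
  have := congrArg ((trivializationAt (EuclideanSpace ℝ (Fin n))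
    (TangentSpace I) α).continuousLinearMapAt ℝ x) h
  simpa only [Trivialization.continuousLinearMapAt_symmL _ h'x, map_zero] using this

lemma chartMetric_symm {α x : M} (hx : x ∈ (chartAt H α).source)
    (v w : EuclideanSpace ℝ (Fin n)) : chartMetric g α x v w = chartMetric g α x w v := by
  rw [chartMetric_apply g hx, chartMetric_apply g hx, g.symm]

lemma chartMetric_coordChange {α β x : M} (hα : x ∈ (chartAt H α).source)
    (hβ : x ∈ (chartAt H β).source) (v w : EuclideanSpace ℝ (Fin n)) :
    chartMetric g β x v w =
      chartMetric g α x (tangentCoordChange I β α x v) (tangentCoordChange I β α x w) := by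
  rw [chartMetric_apply g hα, chartMetric_apply g hβ,
    TangentBundle.symmL_trivializationAt_eq_core hα,
    TangentBundle.symmL_trivializationAt_eq_core hβ]
  have key : ∀ v : EuclideanSpace ℝ (Fin n), tangentCoordChange I α x x
      (tangentCoordChange I β α x v) = tangentCoordChange I β x x v := fun v ↦
    tangentCoordChange_comp (by simp [hα, hβ])
  exact congrArg₂ (fun a b ↦ g.inner x a b) (key v).symm (key w).symm

lemma metricMatrix_apply {α : M} {y : EuclideanSpace ℝ (Fin n)}
    (hy : y ∈ (extChartAt I α).target) (i j : Fin n) :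
    metricMatrix g α y i j = chartMetric g α ((extChartAt I α).symm y)
      (EuclideanSpace.single i 1) (EuclideanSpace.single j 1) :=
  inner_coordVector g hy _ _

end

/-! ### The Riemannian density in a chart -/

section

variable {n : ℕ} {H : Type*} [TopologicalSpace H]
  {I : ModelWithCorners ℝ (EuclideanSpace ℝ (Fin n)) H}
  {M : Type*} [TopologicalSpace M] [ChartedSpace H M] [IsManifold I ∞ M]
  (g : ContMDiffRiemannianMetric I ∞ (EuclideanSpace ℝ (Fin n))
      (fun x : M ↦ TangentSpace I x))

/-- `chartMetric` as an algebraic bilinear form. -/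
def chartBilinForm (α x : M) : LinearMap.BilinForm ℝ (EuclideanSpace ℝ (Fin n)) :=
  LinearMap.mk₂ ℝ (fun v w ↦ chartMetric g α x v w) (by simp) (by simp) (by simp) (by simp)

lemma metricMatrix_eq_toMatrix {α : M} {y : EuclideanSpace ℝ (Fin n)}
    (hy : y ∈ (extChartAt I α).target) :
    metricMatrix g α y = LinearMap.BilinForm.toMatrix
      (EuclideanSpace.basisFun (Fin n) ℝ).toBasis
      (chartBilinForm g α ((extChartAt I α).symm y)) := by
  ext i j
  rw [metricMatrix_apply g hy, LinearMap.BilinForm.toMatrix_apply]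
  simp [chartBilinForm]

lemma det_metricMatrix_pos {α : M} {y : EuclideanSpace ℝ (Fin n)}
    (hy : y ∈ (extChartAt I α).target) : 0 < (metricMatrix g α y).det := by
  have hx : (extChartAt I α).symm y ∈ (chartAt H α).source := by
    rw [← extChartAt_source I]; exact (extChartAt I α).map_target hy
  refine Matrix.PosDef.det_pos (Matrix.PosDef.of_dotProduct_mulVec_pos ?_ fun v hv ↦ ?_)
  · ext i j
    rw [Matrix.conjTranspose_apply, metricMatrix_apply g hy, metricMatrix_apply g hy,
      chartMetric_symm g hx]
    simp
  · rw [star_trivial, metricMatrix_eq_toMatrix g hy,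
      LinearMap.BilinForm.dotProduct_toMatrix_mulVec]
    refine chartMetric_pos g hx ?_
    simpa using hv

lemma continuousOn_det_metricMatrix (α : M) :
    ContinuousOn (fun y ↦ (metricMatrix g α y).det) (extChartAt I α).target := by
  have h : ContinuousOn (metricMatrix g α) (extChartAt I α).target := by
    refine continuousOn_pi.2 fun i ↦ continuousOn_pi.2 fun j ↦ ?_
    have : ContinuousOn (fun y ↦ chartMetric g α ((extChartAt I α).symm y)
        (EuclideanSpace.single i 1) (EuclideanSpace.single j 1)) (extChartAt I α).target := by
      have := (continuousOn_chartMetric g α).comp (continuousOn_extChartAt_symm (I := I) α)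
        (fun y hy ↦ by
          rw [← extChartAt_source I]; exact (extChartAt I α).map_target hy)
      exact (this.clm_apply continuousOn_const).clm_apply continuousOn_const
    exact this.congr fun y hy ↦ metricMatrix_apply g hy i j
  exact (continuous_id.matrix_det).comp_continuousOn h

lemma det_metricMatrix_coordChange {α β : M} {y : EuclideanSpace ℝ (Fin n)}
    (hy : y ∈ (extChartAt I β).target)
    (hα : (extChartAt I β).symm y ∈ (extChartAt I α).source) :
    (metricMatrix g β y).det =
      (tangentCoordChange I β α ((extChartAt I β).symm y)).det ^ 2 *
        (metricMatrix g α (extChartAt I α ((extChartAt I β).symm y))).det := by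
  set x := (extChartAt I β).symm y with hx
  have hβ : x ∈ (extChartAt I β).source := (extChartAt I β).map_target hy
  have hz : extChartAt I α x ∈ (extChartAt I α).target := (extChartAt I α).map_source hα
  rw [metricMatrix_eq_toMatrix g hy, metricMatrix_eq_toMatrix g hz,
    (extChartAt I α).left_inv hα, ← hx]
  have : chartBilinForm g β x = (chartBilinForm g α x).comp
      (tangentCoordChange I β α x : EuclideanSpace ℝ (Fin n) →ₗ[ℝ] EuclideanSpace ℝ (Fin n))
      (tangentCoordChange I β α x : EuclideanSpace ℝ (Fin n) →ₗ[ℝ] EuclideanSpace ℝ (Fin n)) := by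
    rw [extChartAt_source] at hα hβ
    ext v w
    exact chartMetric_coordChange g hα hβ v w
  rw [this, LinearMap.BilinForm.toMatrix_comp (EuclideanSpace.basisFun (Fin n) ℝ).toBasis,
    Matrix.det_mul, Matrix.det_mul, Matrix.det_transpose, LinearMap.det_toMatrix,
    ContinuousLinearMap.det]
  ring

lemma measurableSet_extChartAt_target (α : M) : MeasurableSet (extChartAt I α).target := by
  rw [extChartAt_target]
  exact (((chartAt H α).open_target.preimage I.continuous_symm).measurableSet).inter
    I.isClosed_range.measurableSet

variable [MeasurableSpace M] [BorelSpace M]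

lemma measurableSet_target_inter_preimage (α : M) {s : Set M} (hs : MeasurableSet s) :
    MeasurableSet ((extChartAt I α).target ∩ (extChartAt I α).symm ⁻¹' s) := by
  have h : Measurable ((extChartAt I α).target.domRestrict (extChartAt I α).symm) :=
    (continuousOn_iff_continuous_domRestrict.1 (continuousOn_extChartAt_symm (I := I) α)).measurable
  have := (MeasurableEmbedding.subtype_coe
    (measurableSet_extChartAt_target (I := I) α)).measurableSet_image.2 (h hs)
  convert this using 1
  ext y
  simp [and_comm]

lemma aemeasurable_extChartAt_symm (α : M) :
    AEMeasurable (extChartAt I α).symm (volume.restrict (extChartAt I α).target) :=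
  (continuousOn_extChartAt_symm α).aemeasurable (measurableSet_extChartAt_target α)

lemma aemeasurable_density (α : M) :
    AEMeasurable (fun y ↦ ENNReal.ofReal √(metricMatrix g α y).det)
      (volume.restrict (extChartAt I α).target) :=
  (((Real.continuous_sqrt.comp_continuousOn (continuousOn_det_metricMatrix g α)).aemeasurable
    (measurableSet_extChartAt_target α))).ennreal_ofReal

lemma chartVolume_apply (α : M) {s : Set M} (hs : MeasurableSet s) :
    chartVolume g α s = ∫⁻ y in (extChartAt I α).target ∩ (extChartAt I α).symm ⁻¹' s,
      ENNReal.ofReal √(metricMatrix g α y).det := by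
  rw [chartVolume, Measure.map_apply_of_aemeasurable
    ((aemeasurable_extChartAt_symm α).mono_ac (withDensity_absolutelyContinuous _ _)) hs,
    withDensity_apply', Measure.restrict_restrict' (measurableSet_extChartAt_target α), inter_comm]

lemma lintegral_chartVolume (α : M) {f : M → ℝ≥0∞} (hf : Measurable f) :
    ∫⁻ x, f x ∂chartVolume g α = ∫⁻ y in (extChartAt I α).target,
      ENNReal.ofReal √(metricMatrix g α y).det * f ((extChartAt I α).symm y) := by
  rw [chartVolume, lintegral_map' hf.aemeasurable
    ((aemeasurable_extChartAt_symm α).mono_ac (withDensity_absolutelyContinuous _ _)),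
    lintegral_withDensity_eq_lintegral_mul₀ (aemeasurable_density g α)
      (g := fun y ↦ f ((extChartAt I α).symm y))
      (hf.comp_aemeasurable (aemeasurable_extChartAt_symm α))]
  rfl

lemma volume_eq_zero_of_chartVolume_eq_zero {α : M} {s : Set M} (hs : MeasurableSet s)
    (h : chartVolume g α s = 0) :
    volume ((extChartAt I α).target ∩ (extChartAt I α).symm ⁻¹' s) = 0 := by
  rw [chartVolume_apply g α hs, lintegral_eq_zero_iff' ((aemeasurable_density g α).mono_measure
    (Measure.restrict_mono inter_subset_left le_rfl))] at h
  have hm := measurableSet_target_inter_preimage (I := I) α hs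
  have h2 := (ae_restrict_iff' hm).1 h
  refine measure_mono_null (fun y hy ↦ ?_) h2
  simp only [Pi.zero_apply, ENNReal.ofReal_eq_zero, mem_compl_iff, mem_ofPred_eq, Classical.not_imp,
    not_le]
  exact ⟨hy, Real.sqrt_pos.2 (det_metricMatrix_pos g hy.1)⟩

/-! ### Chart volumes agree on overlaps -/

/-- Change of variables: `det g_ij` is multiplied by the square of the Jacobian determinant of the
coordinate change. -/
lemma chartVolume_eq_of_subset {α β : M} {s : Set M} (hs : MeasurableSet s)
    (hα : s ⊆ (extChartAt I α).source) (hβ : s ⊆ (extChartAt I β).source) :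
    chartVolume g β s = chartVolume g α s := by
  rw [chartVolume_apply g α hs, chartVolume_apply g β hs]
  set A := (extChartAt I β).target ∩ (extChartAt I β).symm ⁻¹' s with hA
  have himg : (extChartAt I α).target ∩ (extChartAt I α).symm ⁻¹' s =
      (extChartAt I α ∘ (extChartAt I β).symm) '' A := by
    ext z
    constructor
    · rintro ⟨hz, hzs⟩
      refine ⟨extChartAt I β ((extChartAt I α).symm z),
        ⟨(extChartAt I β).map_source (hβ hzs), ?_⟩, ?_⟩
      · rw [mem_preimage, (extChartAt I β).left_inv (hβ hzs)]
        exact hzs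
      · rw [Function.comp_apply, (extChartAt I β).left_inv (hβ hzs), (extChartAt I α).right_inv hz]
    · rintro ⟨y, ⟨hy, hys⟩, rfl⟩
      refine ⟨(extChartAt I α).map_source (hα hys), ?_⟩
      rw [mem_preimage, Function.comp_apply, (extChartAt I α).left_inv (hα hys)]
      exact hys
  have hinj : InjOn (extChartAt I α ∘ (extChartAt I β).symm) A := by
    intro y hy z hz h
    exact (extChartAt I β).symm.injOn hy.1 hz.1 ((extChartAt I α).injOn (hα hy.2) (hα hz.2) h)
  have hder : ∀ y ∈ A, HasFDerivWithinAt (extChartAt I α ∘ (extChartAt I β).symm)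
      (tangentCoordChange I β α ((extChartAt I β).symm y)) A y := by
    intro y hy
    have := hasFDerivWithinAt_tangentCoordChange (I := I) (x := β) (y := α)
      (z := (extChartAt I β).symm y) ⟨hβ hy.2, hα hy.2⟩
    rw [(extChartAt I β).right_inv hy.1] at this
    exact this.mono (inter_subset_left.trans (extChartAt_target_subset_range β))
  have hAm : MeasurableSet A := measurableSet_target_inter_preimage β hs
  rw [himg, lintegral_image_eq_lintegral_abs_det_fderiv_mul volume hAm hder hinj]
  refine setLIntegral_congr_fun hAm fun y hy ↦ ?_
  simp only [Function.comp_apply]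
  rw [det_metricMatrix_coordChange g hy.1 (hα hy.2), Real.sqrt_mul (sq_nonneg _),
    Real.sqrt_sq_eq_abs, ENNReal.ofReal_mul (abs_nonneg _)]

lemma chartVolume_inter_source (α : M) {s : Set M} (hs : MeasurableSet s) :
    chartVolume g α (s ∩ (extChartAt I α).source) = chartVolume g α s := by
  rw [chartVolume_apply g α hs, chartVolume_apply g α
    (hs.inter (isOpen_extChartAt_source α).measurableSet)]
  congr 2
  ext y
  simp only [mem_inter_iff, mem_preimage]
  exact ⟨fun h ↦ ⟨h.1, h.2.1⟩, fun h ↦ ⟨h.1, h.2, (extChartAt I α).map_target h.1⟩⟩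

lemma chartVolume_le_of_subset {α β : M} {s : Set M} (hs : MeasurableSet s)
    (hα : s ⊆ (extChartAt I α).source) : chartVolume g β s ≤ chartVolume g α s := by
  rw [← chartVolume_inter_source g β hs, chartVolume_eq_of_subset g
    (hs.inter (isOpen_extChartAt_source β).measurableSet) (inter_subset_left.trans hα)
    inter_subset_right]
  exact measure_mono inter_subset_left

lemma chartVolume_le_riemannianVolume (α : M) : chartVolume g α ≤ riemannianVolume g :=
  le_iSup (fun α ↦ chartVolume g α) α

/-- In the domain of a chart the Riemannian volume is `√(det g_ij) dy`. -/
lemma riemannianVolume_eq_chartVolume {α : M} {s : Set M} (hs : MeasurableSet s)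
    (hα : s ⊆ (extChartAt I α).source) : riemannianVolume g s = chartVolume g α s := by
  refine le_antisymm ?_ (chartVolume_le_riemannianVolume g α s)
  have hsrc : MeasurableSet (extChartAt I α).source := (isOpen_extChartAt_source α).measurableSet
  -- the right-hand side is a measure that dominates all chart volumes
  have key : riemannianVolume g ≤
      chartVolume g α + (riemannianVolume g).restrict (extChartAt I α).sourceᶜ := by
    refine iSup_le fun β ↦ Measure.le_iff.2 fun t ht ↦ ?_
    rw [Measure.add_apply, Measure.restrict_apply ht, ← measure_inter_add_sdiff t hsrc, ← sdiff_eq]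
    refine add_le_add ?_ ?_
    · exact (chartVolume_le_of_subset g (ht.inter hsrc) inter_subset_right).trans
        (measure_mono inter_subset_left)
    · exact chartVolume_le_riemannianVolume g β _
  refine (key s).trans_eq ?_
  rw [Measure.add_apply, Measure.restrict_apply hs, ← sdiff_eq, sdiff_eq_empty.2 hα, measure_empty,
    add_zero]

lemma restrict_riemannianVolume (α : M) :
    (riemannianVolume g).restrict (extChartAt I α).source = chartVolume g α := by
  have hsrc : MeasurableSet (extChartAt I α).source := (isOpen_extChartAt_source α).measurableSet
  ext s hs
  rw [Measure.restrict_apply hs, riemannianVolume_eq_chartVolume g (hs.inter hsrc)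
    inter_subset_right, chartVolume_inter_source g α hs]

/-! ### Finiteness of the Riemannian volume -/

/-- A chart may have infinite volume a priori, as its density can be unbounded near the edge of the
chart; near the centre the density is bounded. -/
lemma exists_isOpen_chartVolume_lt_top (α : M) :
    ∃ V : Set M, IsOpen V ∧ α ∈ V ∧ V ⊆ (extChartAt I α).source ∧ chartVolume g α V < ⊤ := by
  set y₀ := extChartAt I α α
  have hc := continuousOn_det_metricMatrix g α y₀ (mem_extChartAt_target α)
  have hev : ∀ᶠ y in 𝓝[(extChartAt I α).target] y₀,
      (metricMatrix g α y).det < (metricMatrix g α y₀).det + 1 :=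
    hc.eventually (gt_mem_nhds (lt_add_one _))
  obtain ⟨r, hr, hball⟩ := Metric.mem_nhdsWithin_iff.1 hev
  refine ⟨(extChartAt I α).source ∩ extChartAt I α ⁻¹' Metric.ball y₀ r,
    isOpen_extChartAt_preimage' α Metric.isOpen_ball,
    ⟨mem_extChartAt_source α, Metric.mem_ball_self hr⟩, inter_subset_left, ?_⟩
  rw [chartVolume_apply g α (isOpen_extChartAt_preimage' α Metric.isOpen_ball).measurableSet]
  set A := (extChartAt I α).target ∩ (extChartAt I α).symm ⁻¹'
    ((extChartAt I α).source ∩ extChartAt I α ⁻¹' Metric.ball y₀ r)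
  have hA : A ⊆ Metric.ball y₀ r ∩ (extChartAt I α).target := by
    rintro y ⟨hy, -, hyb⟩
    rw [mem_preimage, (extChartAt I α).right_inv hy] at hyb
    exact ⟨hyb, hy⟩
  calc ∫⁻ y in A, ENNReal.ofReal √(metricMatrix g α y).det
      ≤ ∫⁻ y in A, ENNReal.ofReal √((metricMatrix g α y₀).det + 1) := by
        refine setLIntegral_mono measurable_const fun y hy ↦ ?_
        exact ENNReal.ofReal_le_ofReal (Real.sqrt_le_sqrt (hball (hA hy)).le)
    _ = ENNReal.ofReal √((metricMatrix g α y₀).det + 1) * volume A := setLIntegral_const _ _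
    _ < ⊤ := ENNReal.mul_lt_top ENNReal.ofReal_lt_top
        ((measure_mono (hA.trans inter_subset_left)).trans_lt Metric.isBounded_ball.measure_lt_top)

/-- Finitely many sets on which one chart volume is finite cover `M`, and the sum of these chart
volumes dominates all the others. -/
instance isFiniteMeasure_riemannianVolume [CompactSpace M] :
    IsFiniteMeasure (riemannianVolume g) := by
  choose V hVo hV hVs hVfin using exists_isOpen_chartVolume_lt_top g
  obtain ⟨t, ht⟩ := isCompact_univ.elim_finite_subcover V hVo
    (fun x _ ↦ mem_iUnion.2 ⟨x, hV x⟩)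
  have key : riemannianVolume g ≤ ∑ x ∈ t, (chartVolume g x).restrict (V x) := by
    refine iSup_le fun β ↦ Measure.le_iff.2 fun s hs ↦ ?_
    rw [Measure.finsetSum_apply]
    calc chartVolume g β s ≤ chartVolume g β (⋃ x ∈ t, s ∩ V x) := by
          refine measure_mono fun z hz ↦ ?_
          simpa [hz] using ht (mem_univ z)
      _ ≤ ∑ x ∈ t, chartVolume g β (s ∩ V x) := measure_biUnion_finset_le _ _
      _ ≤ ∑ x ∈ t, (chartVolume g x).restrict (V x) s := by
          refine Finset.sum_le_sum fun x _ ↦ ?_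
          rw [Measure.restrict_apply hs]
          exact chartVolume_le_of_subset g (hs.inter (hVo x).measurableSet)
            (inter_subset_right.trans (hVs x))
  refine ⟨(key univ).trans_lt ?_⟩
  rw [Measure.finsetSum_apply]
  refine ENNReal.sum_lt_top.2 fun x _ ↦ ?_
  rw [Measure.restrict_apply_univ]
  exact hVfin x

end

/-! ### Weak gradients of smooth functions -/

section

lemma integrable_mul_of_continuousOn {E : Type*} [NormedAddCommGroup E] [NormedSpace ℝ E]
    [MeasurableSpace E] [BorelSpace E] {μ : Measure E} [IsFiniteMeasureOnCompacts μ]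
    {h φ : E → ℝ} {K : Set E} (hK : IsCompact K) (hh : ContinuousOn h K) (hφ : Continuous φ)
    (hs : Function.support φ ⊆ K) : Integrable (fun y ↦ h y * φ y) μ := by
  have h1 : IntegrableOn (fun y ↦ h y * φ y) K μ :=
    (hh.mul hφ.continuousOn).integrableOn_compact hK
  exact (integrableOn_iff_integrable_of_support_subset
    ((Function.support_mul_subset_right _ _).trans hs)).1 h1

variable {n : ℕ} {H : Type*} [TopologicalSpace H]
  {I : ModelWithCorners ℝ (EuclideanSpace ℝ (Fin n)) H}
  {M : Type*} [TopologicalSpace M] [ChartedSpace H M] [IsManifold I ∞ M]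
  (g : ContMDiffRiemannianMetric I ∞ (EuclideanSpace ℝ (Fin n))
      (fun x : M ↦ TangentSpace I x))

lemma exists_inner_eq (x : M) (ℓ : TangentSpace I x →L[ℝ] ℝ) :
    ∃ X : TangentSpace I x, ∀ w, g.inner x X w = ℓ w := by
  have : FiniteDimensional ℝ (TangentSpace I x) :=
    inferInstanceAs (FiniteDimensional ℝ (EuclideanSpace ℝ (Fin n)))
  let T : TangentSpace I x →ₗ[ℝ] Module.Dual ℝ (TangentSpace I x) :=
    { toFun := fun v ↦ (g.inner x v).toLinearMap
      map_add' := by intro v w; ext z; simp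
      map_smul' := by intro c w; ext z; simp }
  have hinj : Function.Injective T := by
    rw [injective_iff_map_eq_zero]
    intro v hv
    by_contra hne
    have h0 : g.inner x v v = 0 := LinearMap.congr_fun hv v
    exact (g.pos x v hne).ne' h0
  obtain ⟨X, hX⟩ := (LinearMap.injective_iff_surjective_of_finrank_eq_finrank
    (Subspace.dual_finrank_eq (K := ℝ) (V := TangentSpace I x)).symm).1 hinj ℓ.toLinearMap
  exact ⟨X, fun w ↦ LinearMap.congr_fun hX w⟩

/-- The differential of `f : M → ℝ` at `x`, as a linear form. -/
def differential (I : ModelWithCorners ℝ (EuclideanSpace ℝ (Fin n)) H) (f : M → ℝ) (x : M) :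
    TangentSpace I x →L[ℝ] ℝ :=
  mfderiv I 𝓘(ℝ, ℝ) f x

lemma differential_congr {f f' : M → ℝ} {x : M} (h : f =ᶠ[𝓝 x] f') :
    differential I f x = differential I f' x :=
  h.mfderiv_eq

lemma differential_const_mul {f : M → ℝ} (hf : ContMDiff I 𝓘(ℝ, ℝ) ∞ f) (a : ℝ) (x : M) :
    differential I (fun z ↦ a * f z) x = a • differential I f x :=
  const_smul_mfderiv ((hf x).mdifferentiableAt (by simp)) a

/-- The Riemannian gradient: the vector field representing the differential of `f` through `g`. -/
def gradient (f : M → ℝ) (x : M) : TangentSpace I x :=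
  (exists_inner_eq g x (differential I f x)).choose

lemma inner_gradient (f : M → ℝ) (x : M) (w : TangentSpace I x) :
    g.inner x (gradient g f x) w = differential I f x w :=
  (exists_inner_eq g x (differential I f x)).choose_spec w

lemma contDiffOn_comp_extChartAt_symm {f : M → ℝ} (hf : ContMDiff I 𝓘(ℝ, ℝ) ∞ f) (α : M) :
    ContDiffOn ℝ ∞ (fun y ↦ f ((extChartAt I α).symm y)) (extChartAt I α).target :=
  (hf.comp_contMDiffOn (contMDiffOn_extChartAt_symm α)).contDiffOn

/-- In coordinates, the differential of a smooth function is its Fréchet derivative. -/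
lemma differential_coordVector {f : M → ℝ} (hf : ContMDiff I 𝓘(ℝ, ℝ) ∞ f) {α : M}
    {y : EuclideanSpace ℝ (Fin n)} (hy : y ∈ interior (extChartAt I α).target)
    (v : EuclideanSpace ℝ (Fin n)) :
    differential I f ((extChartAt I α).symm y) (coordVector I α y v) =
      fderiv ℝ (fun y ↦ f ((extChartAt I α).symm y)) y v := by
  have hy' := interior_subset hy
  have hr : range I ∈ 𝓝 y :=
    mem_of_superset (mem_interior_iff_mem_nhds.1 hy) (extChartAt_target_subset_range α)
  have h := mfderiv_comp_mfderivWithin (I := 𝓘(ℝ, EuclideanSpace ℝ (Fin n))) (I' := I)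
    (I'' := 𝓘(ℝ, ℝ)) (s := range I) (g := f) (f := (extChartAt I α).symm) y
    ((hf _).mdifferentiableAt (by simp)) (mdifferentiableWithinAt_extChartAt_symm hy')
    ((uniqueMDiffWithinAt_iff_uniqueDiffWithinAt).2 (uniqueDiffWithinAt_of_mem_nhds hr))
  rw [mfderivWithin_eq_fderivWithin, fderivWithin_of_mem_nhds hr] at h
  exact (DFunLike.congr_fun h v).symm

lemma inner_gradient_coordVector {f : M → ℝ} (hf : ContMDiff I 𝓘(ℝ, ℝ) ∞ f) {α : M}
    {y : EuclideanSpace ℝ (Fin n)} (hy : y ∈ interior (extChartAt I α).target)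
    (v : EuclideanSpace ℝ (Fin n)) :
    g.inner ((extChartAt I α).symm y) (gradient g f ((extChartAt I α).symm y))
      (coordVector I α y v) = fderiv ℝ (fun y ↦ f ((extChartAt I α).symm y)) y v := by
  rw [inner_gradient, differential_coordVector hf hy]

lemma hasWeakGradient_gradient {f : M → ℝ} (hf : ContMDiff I 𝓘(ℝ, ℝ) ∞ f) :
    HasWeakGradient g f (gradient g f) := by
  have hcd (α : M) : ContDiffOn ℝ ∞ (fun y ↦ f ((extChartAt I α).symm y))
      (interior (extChartAt I α).target) :=
    (contDiffOn_comp_extChartAt_symm hf α).mono interior_subset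
  have hfd (α : M) (v : EuclideanSpace ℝ (Fin n)) : ContinuousOn
      (fun y ↦ fderiv ℝ (fun y ↦ f ((extChartAt I α).symm y)) y v)
      (interior (extChartAt I α).target) :=
    ((hcd α).continuousOn_fderiv_of_isOpen isOpen_interior (by simp)).clm_apply continuousOn_const
  refine ⟨fun α ↦ (hcd α).continuousOn.locallyIntegrableOn isOpen_interior.measurableSet,
    fun α v ↦ ?_, fun α v ψ hψ hψc hψs ↦ ?_⟩
  · refine (((hfd α v).congr fun y hy ↦ inner_gradient_coordVector g hf hy v)).locallyIntegrableOn
      isOpen_interior.measurableSet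
  · have hdiff : ∀ y ∈ tsupport ψ, DifferentiableAt ℝ (fun y ↦ f ((extChartAt I α).symm y)) y :=
      fun y hy ↦ (((hcd α).contDiffAt (isOpen_interior.mem_nhds (hψs hy))).differentiableAt
        (by simp))
    have hψ' : Continuous (fun y ↦ fderiv ℝ ψ y v) :=
      (hψ.continuous_fderiv (by simp)).clm_apply continuous_const
    have hsupp : Function.support (fun y ↦ fderiv ℝ ψ y v) ⊆ tsupport ψ := by
      intro y hy
      refine support_fderiv_subset ℝ fun h ↦ hy ?_
      simp only [h, _root_.zero_apply]
    rw [integral_mul_fderiv_eq_neg_fderiv_mul_of_integrable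
      (integrable_mul_of_continuousOn hψc ((hfd α v).mono hψs) hψ.continuous (subset_tsupport ψ))
      (integrable_mul_of_continuousOn hψc ((hcd α).continuousOn.mono hψs) hψ' hsupp)
      (integrable_mul_of_continuousOn hψc ((hcd α).continuousOn.mono hψs) hψ.continuous
        (subset_tsupport ψ)) hdiff (fun y _ ↦ hψ.contDiffAt.differentiableAt (by simp))]
    congr 1
    refine integral_congr_ae (Eventually.of_forall fun y ↦ ?_)
    by_cases hy : y ∈ tsupport ψ
    · simp only [inner_gradient_coordVector g hf (hψs hy)]
    · simp only [image_eq_zero_of_notMem_tsupport hy, mul_zero]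

variable [MeasurableSpace M] [BorelSpace M]

/-- The Riemannian volume charges every set that is not Lebesgue negligible in a chart. -/
lemma ae_extChartAt_symm {P : M → Prop} (h : ∀ᵐ x ∂riemannianVolume g, P x) (α : M) :
    ∀ᵐ y ∂(volume.restrict (extChartAt I α).target), P ((extChartAt I α).symm y) := by
  obtain ⟨s, hs, hsm, hs0⟩ := exists_measurable_superset_of_null (ae_iff.1 h)
  have h0 : chartVolume g α s = 0 :=
    le_antisymm ((chartVolume_le_riemannianVolume g α s).trans_eq hs0) zero_le
  rw [ae_restrict_iff' (measurableSet_extChartAt_target α), ae_iff]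
  refine measure_mono_null (fun y hy ↦ ?_) (volume_eq_zero_of_chartVolume_eq_zero g hsm h0)
  rw [mem_ofPred_eq, Classical.not_imp] at hy
  exact ⟨hy.1, hs hy.2⟩

variable {g} in
lemma HasWeakGradient.congr_ae {u u' : M → ℝ} {X : (x : M) → TangentSpace I x}
    (h : HasWeakGradient g u X) (huu' : u =ᵐ[riemannianVolume g] u') :
    HasWeakGradient g u' X := by
  have hae (α : M) := ae_restrict_of_ae_restrict_of_subset (interior_subset)
    (ae_extChartAt_symm g huu' α)
  refine ⟨fun α ↦ (h.locallyIntegrableOn α).congr (hae α), h.locallyIntegrableOn_inner,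
    fun α v ψ hψ hψc hψs ↦ ?_⟩
  rw [← h.integral_eq α v ψ hψ hψc hψs]
  refine integral_congr_ae ?_
  filter_upwards [(ae_restrict_iff' isOpen_interior.measurableSet).1 (hae α)] with y hy
  by_cases hys : y ∈ tsupport ψ
  · rw [hy (hψs hys)]
  · have : fderiv ℝ ψ y = 0 := by
      by_contra hne
      exact hys (support_fderiv_subset ℝ hne)
    simp only [this, _root_.zero_apply, mul_zero]

end

/-! ### Rayleigh quotients of disjointly supported functions -/

section

variable {n : ℕ} {H : Type*} [TopologicalSpace H]
  {I : ModelWithCorners ℝ (EuclideanSpace ℝ (Fin n)) H}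
  {M : Type*} [TopologicalSpace M] [ChartedSpace H M] [IsManifold I ∞ M]
  (g : ContMDiffRiemannianMetric I ∞ (EuclideanSpace ℝ (Fin n))
      (fun x : M ↦ TangentSpace I x))

lemma eventuallyEq_smul_of_disjoint_tsupport {X : Type*} [TopologicalSpace X] {k : ℕ}
    {u : Fin (k + 1) → X → ℝ} (hu : Pairwise fun i j ↦ Disjoint (tsupport (u i)) (tsupport (u j)))
    (x : X) : ∃ i, (∀ j ≠ i, x ∉ tsupport (u j)) ∧
      ∀ a : Fin (k + 1) → ℝ, (fun z ↦ ∑ j, a j * u j z) =ᶠ[𝓝 x] fun z ↦ a i * u i z := by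
  obtain ⟨i, hi⟩ : ∃ i, ∀ j ≠ i, x ∉ tsupport (u j) := by
    by_cases h : ∃ i, x ∈ tsupport (u i)
    · obtain ⟨i, hi⟩ := h
      exact ⟨i, fun j hj hx ↦ (disjoint_left.1 (hu hj)) hx hi⟩
    · push Not at h
      exact ⟨0, fun j _ ↦ h j⟩
  refine ⟨i, hi, fun a ↦ ?_⟩
  have hev : ∀ᶠ z in 𝓝 x, ∀ j ≠ i, u j z = 0 := by
    refine eventually_all.2 fun j ↦ ?_
    by_cases hj : j = i
    · exact Eventually.of_forall fun _ h ↦ absurd hj h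
    · exact (notMem_tsupport_iff_eventuallyEq.1 (hi j hj)).mono fun z hz _ ↦ hz
  filter_upwards [hev] with z hz
  exact Finset.sum_eq_single i (fun j _ hj ↦ by rw [hz j hj, mul_zero]) (by simp)

/-- If the differential of each `u i` is bounded by `√(h i)`, then so is, up to the coefficients,
that of a linear combination of these functions with disjoint supports. -/
lemma inner_gradient_sum_le {k : ℕ} {u h : Fin (k + 1) → M → ℝ}
    (hu : ∀ i, ContMDiff I 𝓘(ℝ, ℝ) ∞ (u i))
    (hd : Pairwise fun i j ↦ Disjoint (tsupport (u i)) (tsupport (u j)))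
    (h0 : ∀ i x, 0 ≤ h i x)
    (hh : ∀ i x w, differential I (u i) x w ^ 2 ≤ h i x * g.inner x w w)
    (a : Fin (k + 1) → ℝ) (x : M) :
    g.inner x (gradient g (fun z ↦ ∑ j, a j * u j z) x)
      (gradient g (fun z ↦ ∑ j, a j * u j z) x) ≤ ∑ j, a j ^ 2 * h j x := by
  obtain ⟨i, -, hi⟩ := eventuallyEq_smul_of_disjoint_tsupport hd x
  set X := gradient g (fun z ↦ ∑ j, a j * u j z) x with hX
  have hterm : a i ^ 2 * h i x ≤ ∑ j, a j ^ 2 * h j x :=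
    Finset.single_le_sum (f := fun j ↦ a j ^ 2 * h j x)
      (fun j _ ↦ mul_nonneg (sq_nonneg _) (h0 j x)) (Finset.mem_univ i)
  refine le_trans ?_ hterm
  have hval : g.inner x X X = a i * differential I (u i) x X := by
    rw [hX, inner_gradient, ← hX, differential_congr (hi a),
      differential_const_mul (hu i)]
    rfl
  by_cases hX0 : X = 0
  · rw [hX0]
    simpa using mul_nonneg (sq_nonneg (a i)) (h0 i x)
  · have hpos := g.pos x X hX0
    have h2 := hh i x X
    have h3 : g.inner x X X * g.inner x X X ≤ (a i ^ 2 * h i x) * g.inner x X X := by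
      calc g.inner x X X * g.inner x X X
          = a i ^ 2 * differential I (u i) x X ^ 2 := by rw [hval]; ring
        _ ≤ a i ^ 2 * (h i x * g.inner x X X) := by gcongr
        _ = _ := by ring
    exact le_of_mul_le_mul_right h3 hpos

lemma sum_mul_sq_of_disjoint_tsupport {X : Type*} [TopologicalSpace X] {k : ℕ}
    {u : Fin (k + 1) → X → ℝ} (hu : Pairwise fun i j ↦ Disjoint (tsupport (u i)) (tsupport (u j)))
    (a : Fin (k + 1) → ℝ) (x : X) : (∑ j, a j * u j x) ^ 2 = ∑ j, a j ^ 2 * u j x ^ 2 := by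
  obtain ⟨i, hi, he⟩ := eventuallyEq_smul_of_disjoint_tsupport hu x
  have h := (he a).self_of_nhds
  simp only at h
  rw [h, Finset.sum_eq_single i, mul_pow]
  · intro j _ hj
    rw [image_eq_zero_of_notMem_tsupport (hi j hj)]
    simp
  · simp

variable [MeasurableSpace M] [BorelSpace M] [CompactSpace M]

lemma lintegral_sum_sq_mul {X : Type*} [MeasurableSpace X] {μ : Measure X} {ι : Type*} [Fintype ι]
    {f : ι → X → ℝ} (hf : ∀ i, Measurable (f i)) (hf0 : ∀ i x, 0 ≤ f i x) (a : ι → ℝ)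
    {τ : X → ℝ} (hτ : Measurable τ) (hτ0 : ∀ x, 0 ≤ τ x) :
    ∫⁻ x, ENNReal.ofReal ((∑ j, a j ^ 2 * f j x) * τ x) ∂μ =
      ∑ j, ENNReal.ofReal (a j ^ 2) * ∫⁻ x, ENNReal.ofReal (f j x * τ x) ∂μ := by
  have : ∀ x, ENNReal.ofReal ((∑ j, a j ^ 2 * f j x) * τ x) =
      ∑ j, ENNReal.ofReal (a j ^ 2) * ENNReal.ofReal (f j x * τ x) := by
    intro x
    rw [Finset.sum_mul, ENNReal.ofReal_sum_of_nonneg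
      fun j _ ↦ mul_nonneg (mul_nonneg (sq_nonneg _) (hf0 j x)) (hτ0 x)]
    refine Finset.sum_congr rfl fun j _ ↦ ?_
    rw [mul_assoc, ENNReal.ofReal_mul (sq_nonneg _)]
  have hm (j : ι) : Measurable fun x ↦ ENNReal.ofReal (f j x * τ x) :=
    ((hf j).mul hτ).ennreal_ofReal
  simp_rw [this]
  rw [lintegral_finsetSum _ fun j _ ↦ (hm j).const_mul _]
  exact Finset.sum_congr rfl fun j _ ↦ lintegral_const_mul _ (hm j)

/-- The span of `k + 1` disjointly supported smooth functions is a test space for `μ_k`, on which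
the Rayleigh quotient is at most the largest Rayleigh quotient of the given functions. -/
lemma eigenvalue_le_of_disjoint_tsupport {k : ℕ} {u h : Fin (k + 1) → M → ℝ}
    (hu : ∀ i, ContMDiff I 𝓘(ℝ, ℝ) ∞ (u i))
    (hd : Pairwise fun i j ↦ Disjoint (tsupport (u i)) (tsupport (u j)))
    (hm : ∀ i, Measurable (h i)) (h0 : ∀ i x, 0 ≤ h i x)
    (hh : ∀ i x w, differential I (u i) x w ^ 2 ≤ h i x * g.inner x w w)
    (hfin : ∀ i, ∫⁻ x, ENNReal.ofReal (h i x) ∂riemannianVolume g < ⊤)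
    {ρ σ : M → ℝ} (hρ : Measurable ρ) (hρ0 : ∀ x, 0 ≤ ρ x) (hσ : Measurable σ)
    (hσ0 : ∀ x, 0 ≤ σ x)
    (hne : ∀ i, ∫⁻ x, ENNReal.ofReal (u i x ^ 2 * ρ x) ∂riemannianVolume g ≠ 0) {C : ℝ≥0∞}
    (hC : ∀ i, ∫⁻ x, ENNReal.ofReal (h i x * σ x) ∂riemannianVolume g ≤
      C * ∫⁻ x, ENNReal.ofReal (u i x ^ 2 * ρ x) ∂riemannianVolume g) :
    eigenvalue g k ρ σ ≤ C := by
  let U : Fin (k + 1) → Lp ℝ 2 (riemannianVolume g) := fun i ↦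
    ContinuousMap.toLp 2 (riemannianVolume g) ℝ ⟨u i, (hu i).continuous⟩
  have hU (a : Fin (k + 1) → ℝ) :
      (∑ i, a i • U i : Lp ℝ 2 (riemannianVolume g)) =ᵐ[riemannianVolume g]
        fun x ↦ ∑ j, a j * u j x := by
    have : ∑ i, a i • U i = ContinuousMap.toLp 2 (riemannianVolume g) ℝ
        (∑ i, a i • (⟨u i, (hu i).continuous⟩ : C(M, ℝ))) := by
      simp only [map_sum, map_smul, U]
    rw [this]
    filter_upwards [ContinuousMap.coeFn_toLp (p := 2) (𝕜 := ℝ) (riemannianVolume g)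
      (∑ i, a i • (⟨u i, (hu i).continuous⟩ : C(M, ℝ)))] with x hx
    rw [hx]
    simp [ContinuousMap.sum_apply]
  have hgrad (a : Fin (k + 1) → ℝ) : HasWeakGradient g
      (∑ i, a i • U i : Lp ℝ 2 (riemannianVolume g)) (gradient g fun x ↦ ∑ j, a j * u j x) := by
    have hs : ContMDiff I 𝓘(ℝ, ℝ) ∞ (fun x ↦ ∑ j, a j * u j x) :=
      contMDiff_finsetSum fun j _ ↦ contMDiff_const.mul (hu j)
    exact (hasWeakGradient_gradient g hs).congr_ae (hU a).symm
  have hden (a : Fin (k + 1) → ℝ) : ∫⁻ x, ENNReal.ofReal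
      ((∑ i, a i • U i : Lp ℝ 2 (riemannianVolume g)) x ^ 2 * ρ x) ∂riemannianVolume g =
      ∑ j, ENNReal.ofReal (a j ^ 2) *
        ∫⁻ x, ENNReal.ofReal (u j x ^ 2 * ρ x) ∂riemannianVolume g := by
    rw [← lintegral_sum_sq_mul (fun i ↦ ((hu i).continuous.measurable.pow_const 2))
      (fun i x ↦ sq_nonneg (u i x)) a hρ hρ0]
    refine lintegral_congr_ae ?_
    filter_upwards [hU a] with x hx
    rw [hx, sum_mul_sq_of_disjoint_tsupport hd]
  have hnum (a : Fin (k + 1) → ℝ) {τ : M → ℝ} (hτ : Measurable τ) (hτ0 : ∀ x, 0 ≤ τ x) :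
      ∫⁻ x, ENNReal.ofReal (g.inner x (gradient g (fun x ↦ ∑ j, a j * u j x) x)
        (gradient g (fun x ↦ ∑ j, a j * u j x) x) * τ x) ∂riemannianVolume g ≤
      ∑ j, ENNReal.ofReal (a j ^ 2) *
        ∫⁻ x, ENNReal.ofReal (h j x * τ x) ∂riemannianVolume g := by
    rw [← lintegral_sum_sq_mul hm h0 a hτ hτ0]
    refine lintegral_mono fun x ↦ ENNReal.ofReal_le_ofReal ?_
    exact mul_le_mul_of_nonneg_right (inner_gradient_sum_le g hu hd h0 hh a x) (hτ0 x)
  have hli : LinearIndependent ℝ U := by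
    rw [Fintype.linearIndependent_iff]
    intro a ha i
    have h1 := hden a
    have h2 : ∫⁻ x, ENNReal.ofReal
        ((∑ i, a i • U i : Lp ℝ 2 (riemannianVolume g)) x ^ 2 * ρ x) ∂riemannianVolume g = 0 := by
      rw [ha]
      refine (lintegral_congr_ae ?_).trans lintegral_zero
      filter_upwards [Lp.coeFn_zero ℝ 2 (riemannianVolume g)] with x hx
      rw [hx]
      simp
    rw [h2, eq_comm, Finset.sum_eq_zero_iff] at h1
    have h3 := (mul_eq_zero.1 (h1 i (Finset.mem_univ i))).resolve_right (hne i)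
    rw [ENNReal.ofReal_eq_zero] at h3
    exact pow_eq_zero_iff two_ne_zero |>.1 (le_antisymm h3 (sq_nonneg _))
  have hW : (∀ v ∈ Submodule.span ℝ (range U), MemH1 g v) ∧
      Module.finrank ℝ (Submodule.span ℝ (range U)) = k + 1 := by
    refine ⟨fun v hv ↦ ?_, by rw [finrank_span_eq_card hli, Fintype.card_fin]⟩
    obtain ⟨a, rfl⟩ := (Submodule.mem_span_range_iff_exists_fun ℝ).1 hv
    refine ⟨_, hgrad a, ?_⟩
    have := hnum a measurable_const (τ := fun _ ↦ 1) (fun _ ↦ zero_le_one)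
    simp only [mul_one] at this
    refine this.trans_lt (ENNReal.sum_lt_top.2 fun j _ ↦ ?_)
    exact ENNReal.mul_lt_top ENNReal.ofReal_lt_top (hfin j)
  refine (iInf₂_le (Submodule.span ℝ (range U)) hW).trans (iSup₂_le fun v hv ↦ ?_)
  obtain ⟨a, rfl⟩ := (Submodule.mem_span_range_iff_exists_fun ℝ).1 hv.1
  refine ENNReal.div_le_of_le_mul ?_
  refine (iInf₂_le _ (hgrad a)).trans ((hnum a hσ hσ0).trans ?_)
  rw [hden, Finset.mul_sum]
  refine Finset.sum_le_sum fun j _ ↦ ?_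
  rw [mul_left_comm]
  exact mul_le_mul_right (hC j) _

end

/-! ### Cutoff functions of small Dirichlet energy -/

section

variable {E : Type*} [NormedAddCommGroup E] [InnerProductSpace ℝ E] [FiniteDimensional ℝ E]
  [MeasurableSpace E] [BorelSpace E] (μ : Measure E) [μ.IsAddHaarMeasure]

lemma integral_sq_norm_fderiv_comp_smul (f : E → ℝ) {c : ℝ} (hc : 0 < c) :
    ∫ y, ‖fderiv ℝ (fun y ↦ f (c • y)) y‖ ^ 2 ∂μ =
      c ^ 2 * (c ^ Module.finrank ℝ E)⁻¹ * ∫ y, ‖fderiv ℝ f y‖ ^ 2 ∂μ := by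
  have h (y : E) : ‖fderiv ℝ (fun y ↦ f (c • y)) y‖ ^ 2 = c ^ 2 * ‖fderiv ℝ f (c • y)‖ ^ 2 := by
    rw [fderiv_comp_smul, norm_smul, mul_pow, Real.norm_eq_abs, sq_abs]
  simp_rw [h]
  rw [integral_const_mul, Measure.integral_comp_smul μ (fun z ↦ ‖fderiv ℝ f z‖ ^ 2),
    abs_of_pos (by positivity), smul_eq_mul, mul_assoc]

lemma sq_norm_sum_eq {ι F : Type*} [SeminormedAddCommGroup F] (s : Finset ι) (v : ι → F)
    (h : ∀ i ∈ s, ∀ j ∈ s, v i ≠ 0 → v j ≠ 0 → i = j) :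
    ‖∑ i ∈ s, v i‖ ^ 2 = ∑ i ∈ s, ‖v i‖ ^ 2 := by
  by_cases hs : ∃ i ∈ s, v i ≠ 0
  · obtain ⟨i, hi, hvi⟩ := hs
    have hz : ∀ j ∈ s, j ≠ i → v j = 0 := fun j hj hji ↦ by
      by_contra hvj
      exact hji (h j hj i hi hvj hvi)
    rw [Finset.sum_eq_single_of_mem i hi hz, Finset.sum_eq_single_of_mem i hi]
    intro j hj hji
    simp [hz j hj hji]
  · push Not at hs
    rw [Finset.sum_eq_zero hs, Finset.sum_eq_zero fun i hi ↦ by simp [hs i hi]]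
    simp

/-- Points have zero capacity in dimension at least two. The cutoff function is the mean of
`χ (2 ^ j c y)`, `j < m`, where `χ` is a bump function: the energies of these functions are bounded
by scaling, since the dimension is at least two, and their gradients have disjoint supports, so
that the energy of the mean is `O(1 / m)`. -/
lemma exists_cutoff_integral_sq_norm_fderiv_le (hE : 2 ≤ Module.finrank ℝ E) {R ε : ℝ}
    (hR : 0 < R) (hε : 0 < ε) :
    ∃ f : E → ℝ, ContDiff ℝ ∞ f ∧ tsupport f ⊆ Metric.closedBall 0 R ∧
      (∃ r > 0, r < R ∧ ∀ y ∈ Metric.ball 0 r, f y = 1) ∧ ∫ y, ‖fderiv ℝ f y‖ ^ 2 ∂μ ≤ ε := by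
  -- the radii are such that the gradient of `χ` vanishes unless `1 < ‖z‖ < 2`
  let χ : ContDiffBump (0 : E) := ⟨5 / 4, 7 / 4, by norm_num, by norm_num⟩
  let l : ℕ → ℝ := fun j ↦ 2 ^ j * (2 / R)
  have hl0 (j : ℕ) : 0 < l j := by positivity
  have hlmono (j : ℕ) : l 0 ≤ l j := by
    have : (1 : ℝ) ≤ 2 ^ j := one_le_pow₀ (by norm_num)
    simp only [l, pow_zero]
    gcongr
  have hldouble {i j : ℕ} (hij : i < j) : 2 * l i ≤ l j := by
    have : (2 : ℝ) ^ (i + 1) ≤ 2 ^ j := pow_le_pow_right₀ (by norm_num) hij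
    calc 2 * l i = 2 ^ (i + 1) * (2 / R) := by simp only [l]; ring
      _ ≤ l j := by simp only [l]; gcongr
  have hχ (z : E) (hz : fderiv ℝ χ z ≠ 0) : 1 < ‖z‖ ∧ ‖z‖ < 2 := by
    constructor
    · by_contra! h
      refine hz ?_
      have hz' : z ∈ Metric.ball 0 χ.rIn := by
        rw [mem_ball_zero_iff]
        exact h.trans_lt (by norm_num [χ])
      rw [(χ.eventuallyEq_one_of_mem_ball hz').fderiv_eq]
      exact fderiv_const_apply 1
    · have hz' : z ∈ tsupport χ := support_fderiv_subset ℝ hz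
      rw [χ.tsupport_eq, mem_closedBall_zero_iff] at hz'
      exact hz'.trans_lt (by norm_num [χ])
  have hχs (j : ℕ) : ContDiff ℝ ∞ fun y : E ↦ χ (l j • y) :=
    χ.contDiff.comp (contDiff_const_smul _)
  have hfdχ (j : ℕ) (y : E) (h : fderiv ℝ (fun y : E ↦ χ (l j • y)) y ≠ 0) :
      1 < l j * ‖y‖ ∧ l j * ‖y‖ < 2 := by
    rw [fderiv_comp_smul] at h
    have := hχ _ (right_ne_zero_of_smul h)
    rwa [norm_smul, Real.norm_of_nonneg (hl0 j).le] at this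
  have huniq (y : E) (i j : ℕ) (hi : fderiv ℝ (fun y : E ↦ χ (l i • y)) y ≠ 0)
      (hj : fderiv ℝ (fun y : E ↦ χ (l j • y)) y ≠ 0) : i = j := by
    have hi' := hfdχ i y hi
    have hj' := hfdχ j y hj
    rcases lt_trichotomy i j with h | h | h
    · nlinarith [mul_le_mul_of_nonneg_right (hldouble h) (norm_nonneg y)]
    · exact h
    · nlinarith [mul_le_mul_of_nonneg_right (hldouble h) (norm_nonneg y)]
  set e₁ : ℝ := l 0 ^ 2 * (l 0 ^ Module.finrank ℝ E)⁻¹ * ∫ y, ‖fderiv ℝ χ y‖ ^ 2 ∂μ with he₁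
  have he₁0 : 0 ≤ e₁ := mul_nonneg (by have := hl0 0; positivity)
    (integral_nonneg fun y ↦ sq_nonneg _)
  have hej (j : ℕ) : ∫ y, ‖fderiv ℝ (fun y : E ↦ χ (l j • y)) y‖ ^ 2 ∂μ ≤ e₁ := by
    rw [integral_sq_norm_fderiv_comp_smul μ _ (hl0 j), he₁]
    refine mul_le_mul_of_nonneg_right ?_ (integral_nonneg fun y ↦ sq_nonneg _)
    obtain ⟨d, hd⟩ := Nat.exists_eq_add_of_le hE
    have hc (c : ℝ) (hc : 0 < c) : c ^ 2 * (c ^ Module.finrank ℝ E)⁻¹ = (c ^ d)⁻¹ := by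
      rw [hd, pow_add]
      field_simp
    rw [hc _ (hl0 j), hc _ (hl0 0)]
    have := hl0 0
    have := hlmono j
    gcongr
  obtain ⟨m, hm⟩ := exists_nat_gt (e₁ / ε)
  have hm0 : (0 : ℝ) < m := (div_nonneg he₁0 hε.le).trans_lt hm
  let f : E → ℝ := fun y ↦ (m : ℝ)⁻¹ * ∑ j ∈ Finset.range m, χ (l j • y)
  have hfs : ContDiff ℝ ∞ f := contDiff_const.mul (ContDiff.sum fun j _ ↦ hχs j)
  have hfd (y : E) : fderiv ℝ f y =
      (m : ℝ)⁻¹ • ∑ j ∈ Finset.range m, fderiv ℝ (fun y : E ↦ χ (l j • y)) y := by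
    rw [fderiv_const_mul, fderiv_fun_sum]
    · exact fun j _ ↦ (hχs j).contDiffAt.differentiableAt (by simp)
    · exact (ContDiff.sum fun j _ ↦ hχs j).contDiffAt.differentiableAt (by simp)
  refine ⟨f, hfs, closure_minimal (fun y hy ↦ ?_) Metric.isClosed_closedBall,
    ⟨(l m)⁻¹, ?_, ?_, ?_⟩, ?_⟩
  · rw [mem_closedBall_zero_iff]
    by_contra! h
    refine hy (mul_eq_zero_of_right _ (Finset.sum_eq_zero fun j _ ↦ χ.zero_of_le_dist ?_))
    rw [dist_zero_right, norm_smul, Real.norm_of_nonneg (hl0 j).le]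
    have h2 : l 0 * R = 2 := by simp only [l]; field_simp
    have h3 : l 0 * R ≤ l j * ‖y‖ := mul_le_mul (hlmono j) h.le hR.le (hl0 j).le
    have h4 : χ.rOut ≤ 2 := by norm_num [χ]
    exact h4.trans (h2.symm.le.trans h3)
  · exact inv_pos.2 (hl0 m)
  · rw [inv_lt_comm₀ (hl0 m) hR]
    have : R⁻¹ < l 0 := by
      simp only [l, pow_zero, one_mul, div_eq_mul_inv]
      have := inv_pos.2 hR
      linarith
    exact this.trans_le (hlmono m)
  · intro y hy
    rw [mem_ball_zero_iff] at hy
    have h1 : ∀ j ∈ Finset.range m, χ (l j • y) = 1 := fun j hj ↦ by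
      refine χ.one_of_mem_closedBall ?_
      rw [mem_closedBall_zero_iff, norm_smul, Real.norm_of_nonneg (hl0 j).le]
      have h2 := hldouble (Finset.mem_range.1 hj)
      have h3 : l m * ‖y‖ ≤ 1 := by
        have := mul_le_mul_of_nonneg_left hy.le (hl0 m).le
        rwa [mul_inv_cancel₀ (hl0 m).ne'] at this
      have h4 : 1 ≤ χ.rIn := by norm_num [χ]
      have h5 := mul_le_mul_of_nonneg_right h2 (norm_nonneg y)
      have h6 := mul_nonneg (hl0 j).le (norm_nonneg y)
      exact le_trans (by linarith) h4
    simp only [f, Finset.sum_congr rfl h1, Finset.sum_const, Finset.card_range, nsmul_eq_mul,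
      mul_one]
    exact inv_mul_cancel₀ hm0.ne'
  · have hint (j : ℕ) : Integrable (fun y ↦ ‖fderiv ℝ (fun y : E ↦ χ (l j • y)) y‖ ^ 2) μ := by
      have hcs : HasCompactSupport fun y : E ↦ χ (l j • y) :=
        χ.hasCompactSupport.comp_homeomorph (Homeomorph.smulOfNeZero (l j) (hl0 j).ne')
      refine Continuous.integrable_of_hasCompactSupport
        (((hχs j).continuous_fderiv (by simp)).norm.pow 2) ?_
      exact (hcs.fderiv ℝ).comp_left (g := fun v : E →L[ℝ] ℝ ↦ ‖v‖ ^ 2) (by simp)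
    calc ∫ y, ‖fderiv ℝ f y‖ ^ 2 ∂μ
        = ∫ y, ((m : ℝ)⁻¹ ^ 2 * ∑ j ∈ Finset.range m,
            ‖fderiv ℝ (fun y : E ↦ χ (l j • y)) y‖ ^ 2) ∂μ := by
          refine integral_congr_ae (Eventually.of_forall fun y ↦ ?_)
          simp only [hfd, norm_smul, mul_pow]
          rw [sq_norm_sum_eq _ _ fun i _ j _ ↦ huniq y i j, Real.norm_eq_abs, sq_abs]
      _ = (m : ℝ)⁻¹ ^ 2 * ∑ j ∈ Finset.range m,
            ∫ y, ‖fderiv ℝ (fun y : E ↦ χ (l j • y)) y‖ ^ 2 ∂μ := by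
          rw [integral_const_mul, integral_finsetSum _ fun j _ ↦ hint j]
      _ ≤ (m : ℝ)⁻¹ ^ 2 * (m * e₁) := by
          gcongr
          refine (Finset.sum_le_card_nsmul _ _ e₁ fun j _ ↦ hej j).trans_eq ?_
          rw [Finset.card_range, nsmul_eq_mul]
      _ = e₁ / m := by field_simp
      _ ≤ ε := by
          rw [div_le_iff₀ hm0]
          exact ((div_lt_iff₀' hε).1 hm).le

end

/-! ### Functions supported in a chart -/

section

variable {n : ℕ} {H : Type*} [TopologicalSpace H]
  {I : ModelWithCorners ℝ (EuclideanSpace ℝ (Fin n)) H}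
  {M : Type*} [TopologicalSpace M] [ChartedSpace H M]

/-- The function on `M` equal to `f` in the coordinates around `α`, extended by zero outside the
domain of the chart. -/
def transplant (I : ModelWithCorners ℝ (EuclideanSpace ℝ (Fin n)) H) (α : M)
    (f : EuclideanSpace ℝ (Fin n) → ℝ) : M → ℝ :=
  (extChartAt I α).source.indicator fun x ↦ f (extChartAt I α x)

variable {α : M} {f : EuclideanSpace ℝ (Fin n) → ℝ}

lemma transplant_extChartAt_symm {y : EuclideanSpace ℝ (Fin n)}
    (hy : y ∈ (extChartAt I α).target) : transplant I α f ((extChartAt I α).symm y) = f y := by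
  rw [transplant, indicator_of_mem ((extChartAt I α).map_target hy), (extChartAt I α).right_inv hy]

lemma transplant_nonneg (hf : ∀ y, 0 ≤ f y) (x : M) : 0 ≤ transplant I α f x :=
  indicator_nonneg (fun _ _ ↦ hf _) x

lemma exists_of_transplant_ne_zero {x : M} (hx : transplant I α f x ≠ 0) :
    ∃ y ∈ (extChartAt I α).target, (extChartAt I α).symm y = x ∧ f y ≠ 0 := by
  have hxs : x ∈ (extChartAt I α).source := mem_of_indicator_ne_zero hx
  refine ⟨extChartAt I α x, (extChartAt I α).map_source hxs, (extChartAt I α).left_inv hxs, ?_⟩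
  rwa [transplant, indicator_of_mem hxs] at hx

section Support

variable [T2Space M]

lemma tsupport_transplant_subset (hc : HasCompactSupport f)
    (hs : tsupport f ⊆ (extChartAt I α).target) :
    tsupport (transplant I α f) ⊆ (extChartAt I α).symm '' tsupport f := by
  refine closure_minimal (fun x hx ↦ ?_)
    (hc.isCompact.image_of_continuousOn ((continuousOn_extChartAt_symm α).mono hs)).isClosed
  obtain ⟨y, -, rfl, hy⟩ := exists_of_transplant_ne_zero hx
  exact ⟨y, subset_tsupport f hy, rfl⟩

lemma tsupport_transplant_subset_source (hc : HasCompactSupport f)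
    (hs : tsupport f ⊆ (extChartAt I α).target) :
    tsupport (transplant I α f) ⊆ (extChartAt I α).source := by
  refine (tsupport_transplant_subset hc hs).trans ?_
  rintro _ ⟨y, hy, rfl⟩
  exact (extChartAt I α).map_target (hs hy)

lemma disjoint_tsupport_transplant {f' : EuclideanSpace ℝ (Fin n) → ℝ} (hc : HasCompactSupport f)
    (hs : tsupport f ⊆ (extChartAt I α).target) (hc' : HasCompactSupport f')
    (hs' : tsupport f' ⊆ (extChartAt I α).target) (h : Disjoint (tsupport f) (tsupport f')) :
    Disjoint (tsupport (transplant I α f)) (tsupport (transplant I α f')) := by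
  refine Disjoint.mono (tsupport_transplant_subset hc hs) (tsupport_transplant_subset hc' hs') ?_
  rw [disjoint_left]
  rintro _ ⟨y, hy, rfl⟩ ⟨z, hz, hzy⟩
  rw [(extChartAt I α).symm.injOn (hs' hz) (hs hy) hzy] at hz
  exact disjoint_left.1 h hy hz

lemma transplant_eventuallyEq {x : M} (hx : x ∈ (extChartAt I α).source) :
    transplant I α f =ᶠ[𝓝 x] fun x ↦ f (extChartAt I α x) :=
  eventuallyEq_of_mem ((isOpen_extChartAt_source α).mem_nhds hx) fun _ hz ↦ indicator_of_mem hz _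

lemma continuous_transplant (hf : Continuous f) (hc : HasCompactSupport f)
    (hs : tsupport f ⊆ (extChartAt I α).target) : Continuous (transplant I α f) := by
  refine continuous_of_tsupport fun x hx ↦ ?_
  have hxs := tsupport_transplant_subset_source hc hs hx
  exact (hf.continuousAt.comp (continuousAt_extChartAt' hxs)).congr
    (transplant_eventuallyEq hxs).symm

lemma contMDiff_transplant [IsManifold I ∞ M] (hf : ContDiff ℝ ∞ f) (hc : HasCompactSupport f)
    (hs : tsupport f ⊆ (extChartAt I α).target) :
    ContMDiff I 𝓘(ℝ, ℝ) ∞ (transplant I α f) := by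
  refine contMDiff_of_tsupport fun x hx ↦ ?_
  have hxs := tsupport_transplant_subset_source hc hs hx
  exact ((hf.contMDiff.contMDiffAt).comp x (contMDiffAt_extChartAt' (by
    rwa [← extChartAt_source I]))).congr_of_eventuallyEq (transplant_eventuallyEq hxs)

end Support

variable [IsManifold I ∞ M] (g : ContMDiffRiemannianMetric I ∞ (EuclideanSpace ℝ (Fin n))
      (fun x : M ↦ TangentSpace I x))

/-- On a compact subset of the image of a chart, the Euclidean metric is bounded by a multiple of
the Riemannian metric. -/
lemma exists_sq_norm_le_chartMetric {K : Set (EuclideanSpace ℝ (Fin n))} (hK : IsCompact K)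
    (hKt : K ⊆ (extChartAt I α).target) :
    ∃ c : ℝ, 0 < c ∧ ∀ y ∈ K, ∀ v : EuclideanSpace ℝ (Fin n),
      ‖v‖ ^ 2 ≤ c * chartMetric g α ((extChartAt I α).symm y) v v := by
  have hsrc {y} (hy : y ∈ (extChartAt I α).target) :
      (extChartAt I α).symm y ∈ (chartAt H α).source := by
    rw [← extChartAt_source I]; exact (extChartAt I α).map_target hy
  -- by homogeneity it suffices to bound the metric from below on unit vectors
  let S : Set (EuclideanSpace ℝ (Fin n) × EuclideanSpace ℝ (Fin n)) := K ×ˢ Metric.sphere 0 1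
  have hS : IsCompact S := hK.prod (isCompact_sphere 0 1)
  have hc : ContinuousOn (fun q : EuclideanSpace ℝ (Fin n) × EuclideanSpace ℝ (Fin n) ↦
      chartMetric g α ((extChartAt I α).symm q.1) q.2 q.2) S := by
    have h1 : ContinuousOn (fun q : EuclideanSpace ℝ (Fin n) × EuclideanSpace ℝ (Fin n) ↦
        chartMetric g α ((extChartAt I α).symm q.1)) S :=
      (continuousOn_chartMetric g α).comp
        ((continuousOn_extChartAt_symm α).comp continuousOn_fst fun q hq ↦ hKt hq.1)
        fun q hq ↦ hsrc (hKt hq.1)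
    exact (h1.clm_apply continuousOn_snd).clm_apply continuousOn_snd
  obtain ⟨b, hb, hbS⟩ : ∃ b : ℝ, 0 < b ∧ ∀ q ∈ S,
      b ≤ chartMetric g α ((extChartAt I α).symm q.1) q.2 q.2 := by
    rcases S.eq_empty_or_nonempty with h | h
    · exact ⟨1, one_pos, by simp [h]⟩
    · obtain ⟨q, hq, hmin⟩ := hS.exists_isMinOn h hc
      refine ⟨_, chartMetric_pos g (hsrc (hKt hq.1)) ?_, fun q' hq' ↦ hmin hq'⟩
      exact ne_zero_of_mem_unit_sphere ⟨q.2, hq.2⟩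
  refine ⟨b⁻¹, inv_pos.2 hb, fun y hy v ↦ ?_⟩
  rcases eq_or_ne v 0 with rfl | hv
  · simp
  · have hv' : 0 < ‖v‖ := norm_pos_iff.2 hv
    have h1 := hbS (y, ‖v‖⁻¹ • v) ⟨hy, by simp [norm_smul, hv'.ne']⟩
    simp only [map_smul, _root_.smul_apply, smul_eq_mul] at h1
    rw [le_inv_mul_iff₀ hb]
    calc b * ‖v‖ ^ 2 ≤ (‖v‖⁻¹ * (‖v‖⁻¹ * chartMetric g α ((extChartAt I α).symm y) v v)) *
          ‖v‖ ^ 2 := by gcongr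
      _ = _ := by field_simp

lemma exists_coordVector_eq {y : EuclideanSpace ℝ (Fin n)} (hy : y ∈ (extChartAt I α).target)
    (w : TangentSpace I ((extChartAt I α).symm y)) : ∃ v, coordVector I α y v = w := by
  have hx : (extChartAt I α).symm y ∈ (trivializationAt (EuclideanSpace ℝ (Fin n))
      (TangentSpace I : M → Type _) α).baseSet := by
    rw [TangentBundle.trivializationAt_baseSet, ← extChartAt_source I]
    exact (extChartAt I α).map_target hy
  exact ⟨_, (coordVector_eq_symmL hy _).trans (Trivialization.symmL_continuousLinearMapAt _ hx w)⟩

/-- The squared Riemannian norm of the differential of a function supported in a chart is bounded by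
a multiple of the squared Euclidean norm of its derivative in the coordinates. -/
lemma sq_differential_transplant_le [T2Space M] {K : Set (EuclideanSpace ℝ (Fin n))}
    {c : ℝ} (hcK : ∀ y ∈ K, ∀ v : EuclideanSpace ℝ (Fin n),
      ‖v‖ ^ 2 ≤ c * chartMetric g α ((extChartAt I α).symm y) v v)
    (hKt : K ⊆ interior (extChartAt I α).target) (hf : ContDiff ℝ ∞ f)
    (hc : HasCompactSupport f) (hs : tsupport f ⊆ K) (x : M) (w : TangentSpace I x) :
    differential I (transplant I α f) x w ^ 2 ≤
      transplant I α (fun y ↦ c * ‖fderiv ℝ f y‖ ^ 2) x * g.inner x w w := by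
  have hst := (hs.trans hKt).trans interior_subset
  by_cases hx : x ∈ tsupport (transplant I α f)
  · obtain ⟨y, hy, rfl⟩ := tsupport_transplant_subset hc hst hx
    have hyt := hst hy
    have hyi := hKt (hs hy)
    obtain ⟨v, rfl⟩ := exists_coordVector_eq hyt w
    rw [differential_coordVector (contMDiff_transplant hf hc hst) hyi,
      transplant_extChartAt_symm hyt, inner_coordVector g hyt]
    have heq : (fun z ↦ transplant I α f ((extChartAt I α).symm z)) =ᶠ[𝓝 y] f :=
      eventuallyEq_of_mem (mem_interior_iff_mem_nhds.1 hyi)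
        fun z hz ↦ transplant_extChartAt_symm hz
    rw [heq.fderiv_eq]
    calc fderiv ℝ f y v ^ 2 = ‖fderiv ℝ f y v‖ ^ 2 := by rw [Real.norm_eq_abs, sq_abs]
      _ ≤ (‖fderiv ℝ f y‖ * ‖v‖) ^ 2 := by gcongr; exact (fderiv ℝ f y).le_opNorm v
      _ = ‖fderiv ℝ f y‖ ^ 2 * ‖v‖ ^ 2 := mul_pow _ _ _
      _ ≤ ‖fderiv ℝ f y‖ ^ 2 * (c * chartMetric g α ((extChartAt I α).symm y) v v) := by
        gcongr
        exact hcK y (hs hy) v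
      _ = _ := by ring
  · have h0 : differential I (transplant I α f) x = 0 := by
      rw [differential_congr (notMem_tsupport_iff_eventuallyEq.1 hx)]
      exact mfderiv_const
    have h1 : transplant I α (fun y ↦ c * ‖fderiv ℝ f y‖ ^ 2) x = 0 := by
      by_contra hne
      obtain ⟨y, hyt, rfl, hy⟩ := exists_of_transplant_ne_zero hne
      have hfy : fderiv ℝ f y ≠ 0 := fun h ↦ hy (by simp [h])
      have hyK : y ∈ tsupport f := support_fderiv_subset ℝ hfy
      refine hfy ?_
      have hc' : ContinuousAt (extChartAt I α).symm y :=
        (continuousOn_extChartAt_symm α).continuousAt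
          (mem_interior_iff_mem_nhds.1 (hKt (hs hyK)))
      have h2 := hc'.eventually (notMem_tsupport_iff_eventuallyEq.1 hx)
      have h3 : f =ᶠ[𝓝 y] 0 := by
        filter_upwards [h2, mem_interior_iff_mem_nhds.1 (hKt (hs hyK))] with z hz hzt
        rwa [transplant_extChartAt_symm hzt] at hz
      rw [h3.fderiv_eq]
      exact fderiv_const_apply 0
    rw [h0, h1]
    simp

variable [MeasurableSpace M] [BorelSpace M] [T2Space M]

lemma lintegral_transplant (hf : Continuous f) (hc : HasCompactSupport f)
    (hs : tsupport f ⊆ (extChartAt I α).target) :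
    ∫⁻ x, ENNReal.ofReal (transplant I α f x) ∂riemannianVolume g =
      ∫⁻ y in (extChartAt I α).target,
        ENNReal.ofReal √(metricMatrix g α y).det * ENNReal.ofReal (f y) := by
  have hm : Measurable fun x ↦ ENNReal.ofReal (transplant I α f x) :=
    (continuous_transplant hf hc hs).measurable.ennreal_ofReal
  have hsupp : Function.support (fun x ↦ ENNReal.ofReal (transplant I α f x)) ⊆
      (extChartAt I α).source := by
    intro x hx
    by_contra hxs
    rw [Function.mem_support, transplant, indicator_of_notMem hxs, ENNReal.ofReal_zero] at hx
    exact hx rfl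
  rw [← setLIntegral_eq_of_support_subset hsupp, restrict_riemannianVolume,
    lintegral_chartVolume g α hm]
  refine setLIntegral_congr_fun (measurableSet_extChartAt_target α) fun y hy ↦ ?_
  simp only [transplant_extChartAt_symm hy]

end

/-! ### Plateau systems -/

section

variable {n : ℕ} {H : Type*} [TopologicalSpace H]
  {I : ModelWithCorners ℝ (EuclideanSpace ℝ (Fin n)) H}
  {M : Type*} [TopologicalSpace M] [ChartedSpace H M] [IsManifold I ∞ M]
  (g : ContMDiffRiemannianMetric I ∞ (EuclideanSpace ℝ (Fin n))
      (fun x : M ↦ TangentSpace I x))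
  [MeasurableSpace M]

/-- A plateau system of energy `ε`: functions `u i` with disjoint supports, each equal to `1` where
the density `q i` of mass one does not vanish. The function `h i` dominates the squared norm of the
gradient of `u i`, has integral at most `ε`, and vanishes wherever one of the densities `q j` does
not. -/
structure IsPlateauSystem {k : ℕ} (ε : ℝ) (u h q : Fin (k + 1) → M → ℝ) : Prop where
  contMDiff (i) : ContMDiff I 𝓘(ℝ, ℝ) ∞ (u i)
  disjoint : Pairwise fun i j ↦ Disjoint (tsupport (u i)) (tsupport (u j))
  measurable (i) : Measurable (h i)
  nonneg (i x) : 0 ≤ h i x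
  sq_differential_le (i x w) : differential I (u i) x w ^ 2 ≤ h i x * g.inner x w w
  contMDiff_density (i) : ContMDiff I 𝓘(ℝ, ℝ) ∞ (q i)
  density_nonneg (i x) : 0 ≤ q i x
  integral_density (i) : ∫ x, q i x ∂riemannianVolume g = 1
  eq_one_of_density_ne_zero (i x) : q i x ≠ 0 → u i x = 1
  eq_zero_of_density_ne_zero (i j x) : q j x ≠ 0 → h i x = 0
  lintegral_le (i) : ∫⁻ x, ENNReal.ofReal (h i x) ∂riemannianVolume g ≤ ENNReal.ofReal ε

lemma exists_pairwise_disjoint_closedBall {E : Type*} [NormedAddCommGroup E] [NormedSpace ℝ E]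
    [Nontrivial E] (y : E) {δ : ℝ} (hδ : 0 < δ) (k : ℕ) :
    ∃ (R : ℝ) (c : Fin (k + 1) → E), 0 < R ∧
      (∀ i, Metric.closedBall (c i) R ⊆ Metric.closedBall y δ) ∧
      Pairwise fun i j ↦ Disjoint (Metric.closedBall (c i) R) (Metric.closedBall (c j) R) := by
  obtain ⟨e, he⟩ := exists_norm_eq E zero_le_one
  set R : ℝ := δ / (3 * (k + 1)) with hR
  have hR0 : 0 < R := by positivity
  have hRδ : 3 * R * (k + 1) = δ := by rw [hR]; field_simp
  refine ⟨R, fun i ↦ y + (3 * R * (i : ℕ)) • e, hR0, fun i ↦ ?_, fun i j hij ↦ ?_⟩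
  · refine Metric.closedBall_subset_closedBall' ?_
    have hi : ((i : ℕ) : ℝ) ≤ k := by exact_mod_cast Nat.le_of_lt_succ i.2
    rw [dist_self_add_left, norm_smul, he, mul_one, Real.norm_of_nonneg (by positivity), ← hRδ]
    nlinarith
  · refine Metric.closedBall_disjoint_closedBall ?_
    rw [dist_add_left, dist_eq_norm, ← sub_smul, norm_smul, he, mul_one, ← mul_sub, norm_mul,
      Real.norm_of_nonneg (by positivity : 0 ≤ 3 * R)]
    have h1 : (1 : ℝ) ≤ ‖((i : ℕ) : ℝ) - ((j : ℕ) : ℝ)‖ := by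
      have : (1 : ℤ) ≤ |((i : ℕ) : ℤ) - ((j : ℕ) : ℤ)| := by
        refine Int.one_le_abs (sub_ne_zero.2 fun h ↦ hij (Fin.ext ?_))
        exact_mod_cast h
      rw [Real.norm_eq_abs]
      exact_mod_cast this
    nlinarith

variable [BorelSpace M] [CompactSpace M] [T2Space M]

lemma integral_transplant_pos {α : M} {f : EuclideanSpace ℝ (Fin n) → ℝ} (hf : Continuous f)
    (hc : HasCompactSupport f) (hs : tsupport f ⊆ (extChartAt I α).target) (hf0 : ∀ y, 0 ≤ f y)
    (hne : f ≠ 0) : 0 < ∫ x, transplant I α f x ∂riemannianVolume g := by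
  have hcont := continuous_transplant hf hc hs
  rw [integral_pos_iff_support_of_nonneg (fun x ↦ transplant_nonneg hf0 x)
    (hcont.integrable_of_hasCompactSupport (HasCompactSupport.of_compactSpace _)), pos_iff_ne_zero]
  intro h0
  have h1 := (ae_restrict_iff' (measurableSet_extChartAt_target α)).1
    (ae_extChartAt_symm g (P := fun x ↦ transplant I α f x = 0) (ae_iff.2 h0) α)
  have h2 : f =ᵐ[volume] 0 := by
    filter_upwards [h1] with y hy
    by_cases hyt : y ∈ (extChartAt I α).target
    · exact (transplant_extChartAt_symm hyt).symm.trans (hy hyt)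
    · exact image_eq_zero_of_notMem_tsupport fun h ↦ hyt (hs h)
  exact hne ((hf.ae_eq_iff_eq volume continuous_zero).1 h2)

/-- Plateau systems of arbitrarily small energy exist in dimension at least two: in small balls
inside a chart, take cutoff functions of small Dirichlet energy. -/
lemma exists_isPlateauSystem (hn : 2 ≤ n) [Nonempty M] (k : ℕ) {ε : ℝ} (hε : 0 < ε) :
    ∃ u h q : Fin (k + 1) → M → ℝ, IsPlateauSystem g ε u h q := by
  obtain ⟨α⟩ := ‹Nonempty M›
  obtain ⟨y₀, hy₀⟩ := interior_extChartAt_target_nonempty I α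
  obtain ⟨δ, hδ, hball⟩ := Metric.nhds_basis_closedBall.mem_iff.1 (isOpen_interior.mem_nhds hy₀)
  have : Nontrivial (EuclideanSpace ℝ (Fin n)) :=
    Module.nontrivial_of_finrank_pos (R := ℝ) (by rw [finrank_euclideanSpace_fin]; omega)
  obtain ⟨R, c, hR, hcb, hdisj⟩ := exists_pairwise_disjoint_closedBall y₀ hδ k
  set K := Metric.closedBall y₀ δ
  have hK : IsCompact K := isCompact_closedBall y₀ δ
  have hKt : K ⊆ (extChartAt I α).target := hball.trans interior_subset
  obtain ⟨a, ha, haK⟩ := exists_sq_norm_le_chartMetric g hK hKt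
  obtain ⟨D, hD, hDK⟩ : ∃ D : ℝ, 0 < D ∧ ∀ y ∈ K, √(metricMatrix g α y).det ≤ D := by
    obtain ⟨D, hD⟩ := hK.exists_bound_of_continuousOn
      ((Real.continuous_sqrt.comp_continuousOn (continuousOn_det_metricMatrix g α)).mono hKt)
    refine ⟨max D 1, by positivity, fun y hy ↦ ?_⟩
    exact ((Real.le_norm_self _).trans (hD y hy)).trans (le_max_left _ _)
  obtain ⟨f₀, hf₀, hf₀s, ⟨r, hr, hrR, hf₀1⟩, hf₀e⟩ := exists_cutoff_integral_sq_norm_fderiv_le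
    (volume : Measure (EuclideanSpace ℝ (Fin n))) (by rwa [finrank_euclideanSpace_fin]) hR
    (show 0 < ε / (D * a) by positivity)
  let f : Fin (k + 1) → EuclideanSpace ℝ (Fin n) → ℝ := fun i y ↦ f₀ (y - c i)
  have hf (i) : ContDiff ℝ ∞ (f i) := hf₀.comp (contDiff_id.sub contDiff_const)
  have hfs (i) : tsupport (f i) ⊆ Metric.closedBall (c i) R := by
    refine closure_minimal (fun y hy ↦ ?_) Metric.isClosed_closedBall
    have := hf₀s (subset_tsupport f₀ hy)
    rwa [mem_closedBall_zero_iff, ← dist_eq_norm] at this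
  have hfc (i) : HasCompactSupport (f i) :=
    (isCompact_closedBall (c i) R).of_isClosed_subset (isClosed_tsupport _) (hfs i)
  have hfK (i) : tsupport (f i) ⊆ K := (hfs i).trans (hcb i)
  have hf1 (i) (y) (hy : y ∈ Metric.ball (c i) r) : f i y = 1 :=
    hf₀1 _ (by rwa [mem_ball_zero_iff, ← dist_eq_norm])
  let φ : ∀ i, ContDiffBump (c i) := fun i ↦ ⟨r / 4, r / 2, by positivity, by linarith⟩
  have hφb (i) (y) (hy : φ i y ≠ 0) : y ∈ Metric.ball (c i) r := by
    have : y ∈ Function.support (φ i) := hy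
    rw [(φ i).support_eq] at this
    exact Metric.ball_subset_ball (by linarith : r / 2 ≤ r) this
  have hφs (i) : tsupport (φ i) ⊆ (extChartAt I α).target := by
    rw [(φ i).tsupport_eq]
    exact ((Metric.closedBall_subset_closedBall (by linarith : r / 2 ≤ R)).trans (hcb i)).trans hKt
  have hfd (i j) (y) (hy : φ j y ≠ 0) : fderiv ℝ (f i) y = 0 := by
    have hyb := hφb j y hy
    by_cases hij : i = j
    · subst hij
      have h1 : f i =ᶠ[𝓝 y] fun _ ↦ 1 :=
        eventuallyEq_of_mem (Metric.isOpen_ball.mem_nhds hyb) (hf1 i)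
      rw [h1.fderiv_eq]
      exact fderiv_const_apply 1
    · by_contra hne
      exact disjoint_left.1 (hdisj hij) (hfs i (support_fderiv_subset ℝ hne))
        (Metric.ball_subset_closedBall (Metric.ball_subset_ball hrR.le hyb))
  let J : Fin (k + 1) → ℝ := fun i ↦ ∫ x, transplant I α (φ i) x ∂riemannianVolume g
  have hJ (i) : 0 < J i := integral_transplant_pos g (φ i).continuous (φ i).hasCompactSupport
    (hφs i) (fun y ↦ (φ i).nonneg) fun h ↦ by
      have := (φ i).one_of_mem_closedBall (Metric.mem_closedBall_self (φ i).rIn_pos.le)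
      rw [h] at this
      exact zero_ne_one this
  let e : Fin (k + 1) → EuclideanSpace ℝ (Fin n) → ℝ := fun i y ↦ a * ‖fderiv ℝ (f i) y‖ ^ 2
  have hecont (i) : Continuous (e i) :=
    continuous_const.mul (((hf i).continuous_fderiv (by simp)).norm.pow 2)
  have hec (i) : HasCompactSupport (e i) :=
    ((hfc i).fderiv ℝ).comp_left (g := fun v : EuclideanSpace ℝ (Fin n) →L[ℝ] ℝ ↦ a * ‖v‖ ^ 2)
      (by simp)
  have hes (i) : tsupport (e i) ⊆ K := by
    refine closure_minimal (fun y hy ↦ hfK i (support_fderiv_subset ℝ fun h ↦ hy ?_))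
      Metric.isClosed_closedBall
    simp only [e, h, norm_zero]
    ring
  refine ⟨fun i ↦ transplant I α (f i), fun i ↦ transplant I α (e i),
    fun i x ↦ (J i)⁻¹ * transplant I α (φ i) x,
    { contMDiff := fun i ↦ contMDiff_transplant (hf i) (hfc i) ((hfK i).trans hKt)
      disjoint := fun i j hij ↦ disjoint_tsupport_transplant (hfc i) ((hfK i).trans hKt) (hfc j)
        ((hfK j).trans hKt) ((hdisj hij).mono (hfs i) (hfs j))
      measurable := fun i ↦
        (continuous_transplant (hecont i) (hec i) ((hes i).trans hKt)).measurable
      nonneg := fun i ↦ transplant_nonneg fun y ↦ by positivity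
      sq_differential_le := fun i ↦
        sq_differential_transplant_le g haK hball (hf i) (hfc i) (hfK i)
      contMDiff_density := fun i ↦ contMDiff_const.mul
        (contMDiff_transplant (φ i).contDiff (φ i).hasCompactSupport (hφs i))
      density_nonneg := fun i x ↦ mul_nonneg (inv_pos.2 (hJ i)).le
        (transplant_nonneg (fun y ↦ (φ i).nonneg) x)
      integral_density := fun i ↦ by
        rw [integral_const_mul]
        exact inv_mul_cancel₀ (hJ i).ne'
      eq_one_of_density_ne_zero := fun i x hx ↦ ?_
      eq_zero_of_density_ne_zero := fun i j x hx ↦ ?_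
      lintegral_le := fun i ↦ ?_ }⟩
  · obtain ⟨y, hyt, rfl, hy⟩ := exists_of_transplant_ne_zero (right_ne_zero_of_mul hx)
    rw [transplant_extChartAt_symm hyt, hf1 i y (hφb i y hy)]
  · obtain ⟨y, hyt, rfl, hy⟩ := exists_of_transplant_ne_zero (right_ne_zero_of_mul hx)
    rw [transplant_extChartAt_symm hyt]
    simp only [e, hfd i j y hy, norm_zero]
    ring
  · rw [lintegral_transplant g (hecont i) (hec i) ((hes i).trans hKt)]
    have hei : Integrable (e i) := (hecont i).integrable_of_hasCompactSupport (hec i)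
    have he0 (y) : 0 ≤ e i y := by positivity
    calc ∫⁻ y in (extChartAt I α).target,
          ENNReal.ofReal √(metricMatrix g α y).det * ENNReal.ofReal (e i y)
        ≤ ∫⁻ y in (extChartAt I α).target, ENNReal.ofReal D * ENNReal.ofReal (e i y) := by
          refine lintegral_mono fun y ↦ ?_
          by_cases hy : y ∈ K
          · exact mul_le_mul_left (ENNReal.ofReal_le_ofReal (hDK y hy)) _
          · simp [image_eq_zero_of_notMem_tsupport fun h ↦ hy (hes i h)]
      _ ≤ ∫⁻ y, ENNReal.ofReal D * ENNReal.ofReal (e i y) := setLIntegral_le_lintegral _ _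
      _ = ENNReal.ofReal D * ENNReal.ofReal (∫ y, e i y) := by
          rw [lintegral_const_mul' _ _ ENNReal.ofReal_ne_top,
            ofReal_integral_eq_lintegral_ofReal hei (Eventually.of_forall he0)]
      _ = ENNReal.ofReal (D * (a * ∫ y, ‖fderiv ℝ f₀ y‖ ^ 2)) := by
          rw [← ENNReal.ofReal_mul hD.le]
          congr 2
          simp only [e, f, integral_const_mul, fderiv_comp_sub]
          rw [integral_sub_right_eq_self (fun y ↦ ‖fderiv ℝ f₀ y‖ ^ 2) (c i)]
      _ ≤ ENNReal.ofReal ε := by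
          refine ENNReal.ofReal_le_ofReal ?_
          rw [← mul_assoc, mul_comm]
          exact (le_div_iff₀ (by positivity)).1 hf₀e

end

/-! ### Concentrated densities -/

section

variable {n : ℕ} {H : Type*} [TopologicalSpace H]
  {I : ModelWithCorners ℝ (EuclideanSpace ℝ (Fin n)) H}
  {M : Type*} [TopologicalSpace M] [ChartedSpace H M] [IsManifold I ∞ M]
  {g : ContMDiffRiemannianMetric I ∞ (EuclideanSpace ℝ (Fin n))
      (fun x : M ↦ TangentSpace I x)}
  [MeasurableSpace M] [BorelSpace M] [CompactSpace M]
  {k : ℕ} {ε δ : ℝ} {u h q : Fin (k + 1) → M → ℝ}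

/-- The mean value of `δ + ∑ q i`, for densities `q i`, `i ≤ k`, of mass one. -/
def concentratedMean (g : ContMDiffRiemannianMetric I ∞ (EuclideanSpace ℝ (Fin n))
      (fun x : M ↦ TangentSpace I x)) (k : ℕ) (δ : ℝ) : ℝ :=
  δ + (k + 1) / (riemannianVolume g).real univ

/-- The density `δ + ∑ q i`, normalized to have mean value one. As `δ` tends to zero, it tends to
zero where all the `q i` vanish. -/
def concentratedDensity (g : ContMDiffRiemannianMetric I ∞ (EuclideanSpace ℝ (Fin n))
      (fun x : M ↦ TangentSpace I x)) (q : Fin (k + 1) → M → ℝ) (δ : ℝ) (x : M) : ℝ :=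
  (δ + ∑ i, q i x) / concentratedMean g k δ

lemma concentratedMean_pos (hδ : 0 < δ) : 0 < concentratedMean g k δ :=
  add_pos_of_pos_of_nonneg hδ (div_nonneg (by positivity) measureReal_nonneg)

namespace IsPlateauSystem

variable (S : IsPlateauSystem g ε u h q)
include S

lemma integrable_density (i : Fin (k + 1)) : Integrable (q i) (riemannianVolume g) :=
  (S.contMDiff_density i).continuous.integrable_of_hasCompactSupport
    (HasCompactSupport.of_compactSpace _)

lemma volume_pos : 0 < (riemannianVolume g).real univ := by
  refine ENNReal.toReal_pos (fun h0 ↦ ?_) (measure_ne_top _ _)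
  rw [Measure.measure_univ_eq_zero] at h0
  have := S.integral_density 0
  rw [h0, integral_zero_measure] at this
  exact zero_ne_one this

lemma concentratedDensity_pos (hδ : 0 < δ) (x : M) : 0 < concentratedDensity g q δ x :=
  div_pos (add_pos_of_pos_of_nonneg hδ (Finset.sum_nonneg fun i _ ↦ S.density_nonneg i x))
    (concentratedMean_pos hδ)

lemma contMDiff_concentratedDensity (δ : ℝ) :
    ContMDiff I 𝓘(ℝ, ℝ) ∞ (concentratedDensity g q δ) := by
  have : ContMDiff I 𝓘(ℝ, ℝ) ∞ fun x ↦ (δ + ∑ i, q i x) * (concentratedMean g k δ)⁻¹ :=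
    (contMDiff_const.add (contMDiff_finsetSum fun i _ ↦ S.contMDiff_density i)).mul contMDiff_const
  simp only [← div_eq_mul_inv] at this
  exact this

lemma concentratedDensity_mem (hδ : 0 < δ) :
    concentratedDensity g q δ ∈ normalizedDensities g := by
  refine ⟨S.contMDiff_concentratedDensity δ, S.concentratedDensity_pos hδ, ?_⟩
  have hV := S.volume_pos
  have hA := concentratedMean_pos (g := g) (k := k) hδ
  simp only [average_eq, concentratedDensity]
  rw [integral_div, integral_add (integrable_const _)
    (integrable_finsetSum _ fun i _ ↦ S.integrable_density i),
    integral_finsetSum _ fun i _ ↦ S.integrable_density i]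
  simp only [S.integral_density, integral_const, Finset.sum_const, Finset.card_univ,
    Fintype.card_fin, nsmul_eq_mul, smul_eq_mul, mul_one]
  rw [← div_eq_inv_mul, div_div, div_eq_one_iff_eq (by positivity), concentratedMean]
  push_cast
  field_simp

/-- Where the gradients of the test functions live, the concentrated density is constant. -/
lemma mul_concentratedDensity_rpow (i : Fin (k + 1)) (x : M) (p : ℝ) :
    h i x * concentratedDensity g q δ x ^ p = h i x * (δ / concentratedMean g k δ) ^ p := by
  by_cases hx : ∃ j, q j x ≠ 0
  · obtain ⟨j, hj⟩ := hx
    rw [S.eq_zero_of_density_ne_zero i j x hj, zero_mul, zero_mul]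
  · push Not at hx
    rw [concentratedDensity, Finset.sum_eq_zero fun j _ ↦ hx j, add_zero]

lemma lintegral_mul_concentratedDensity_rpow_le (hδ : 0 < δ) (i : Fin (k + 1)) (p : ℝ) :
    ∫⁻ x, ENNReal.ofReal (h i x * concentratedDensity g q δ x ^ p) ∂riemannianVolume g ≤
      ENNReal.ofReal ((δ / concentratedMean g k δ) ^ p * ε) := by
  have hA := concentratedMean_pos (g := g) (k := k) hδ
  have h0 : 0 ≤ (δ / concentratedMean g k δ) ^ p := by positivity
  simp only [S.mul_concentratedDensity_rpow, mul_comm (h i _), ENNReal.ofReal_mul h0]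
  rw [lintegral_const_mul' _ _ ENNReal.ofReal_ne_top]
  gcongr
  exact S.lintegral_le i

lemma ofReal_inv_concentratedMean_le (hδ : 0 < δ) (i : Fin (k + 1)) :
    ENNReal.ofReal (concentratedMean g k δ)⁻¹ ≤
      ∫⁻ x, ENNReal.ofReal (u i x ^ 2 * concentratedDensity g q δ x) ∂riemannianVolume g := by
  have hA := concentratedMean_pos (g := g) (k := k) hδ
  calc ENNReal.ofReal (concentratedMean g k δ)⁻¹
      = ENNReal.ofReal (∫ x, q i x / concentratedMean g k δ ∂riemannianVolume g) := by
        rw [integral_div, S.integral_density, one_div]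
    _ = ∫⁻ x, ENNReal.ofReal (q i x / concentratedMean g k δ) ∂riemannianVolume g :=
        ofReal_integral_eq_lintegral_ofReal ((S.integrable_density i).div_const _)
          (Eventually.of_forall fun x ↦ div_nonneg (S.density_nonneg i x) hA.le)
    _ ≤ _ := by
        refine lintegral_mono fun x ↦ ENNReal.ofReal_le_ofReal ?_
        by_cases hx : q i x = 0
        · rw [hx, zero_div]
          exact mul_nonneg (sq_nonneg _) (S.concentratedDensity_pos hδ x).le
        · rw [S.eq_one_of_density_ne_zero i x hx, one_pow, one_mul, concentratedDensity]
          gcongr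
          have := Finset.single_le_sum (f := fun j ↦ q j x) (fun j _ ↦ S.density_nonneg j x)
            (Finset.mem_univ i)
          linarith

lemma eigenvalue_concentratedDensity_rpow_le (hδ : 0 < δ) (p : ℝ) :
    eigenvalue g k (concentratedDensity g q δ) (fun x ↦ concentratedDensity g q δ x ^ p) ≤
      ENNReal.ofReal ((δ / concentratedMean g k δ) ^ p * ε * concentratedMean g k δ) := by
  have hA := concentratedMean_pos (g := g) (k := k) hδ
  have hρ := (S.contMDiff_concentratedDensity δ).continuous.measurable
  refine eigenvalue_le_of_disjoint_tsupport g S.contMDiff S.disjoint S.measurable S.nonneg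
    S.sq_differential_le (fun i ↦ (S.lintegral_le i).trans_lt ENNReal.ofReal_lt_top) hρ
    (fun x ↦ (S.concentratedDensity_pos hδ x).le) (hρ.pow_const p)
    (fun x ↦ (Real.rpow_pos_of_pos (S.concentratedDensity_pos hδ x) p).le) (fun i ↦ ?_) fun i ↦ ?_
  · exact ((ENNReal.ofReal_pos.2 (inv_pos.2 hA)).trans_le
      (S.ofReal_inv_concentratedMean_le hδ i)).ne'
  · calc _ ≤ ENNReal.ofReal ((δ / concentratedMean g k δ) ^ p * ε) :=
          S.lintegral_mul_concentratedDensity_rpow_le hδ i p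
      _ = ENNReal.ofReal ((δ / concentratedMean g k δ) ^ p * ε * concentratedMean g k δ) *
            ENNReal.ofReal (concentratedMean g k δ)⁻¹ := by
          rw [← ENNReal.ofReal_mul' (inv_pos.2 hA).le, mul_inv_cancel_right₀ hA.ne']
      _ ≤ _ := by
          gcongr
          exact S.ofReal_inv_concentratedMean_le hδ i

lemma lintegral_sq_ne_zero (i : Fin (k + 1)) :
    ∫⁻ x, ENNReal.ofReal (u i x ^ 2 * 1) ∂riemannianVolume g ≠ 0 := by
  intro h0
  rw [lintegral_eq_zero_iff
    (((S.contMDiff i).continuous.measurable.pow_const 2).mul_const 1).ennreal_ofReal] at h0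
  have hq : q i =ᵐ[riemannianVolume g] 0 := by
    filter_upwards [h0] with x hx
    by_contra hne
    rw [S.eq_one_of_density_ne_zero i x hne] at hx
    simp at hx
  have := S.integral_density i
  rw [integral_congr_ae hq] at this
  simp at this

lemma lintegral_sq_ne_top (i : Fin (k + 1)) :
    ∫⁻ x, ENNReal.ofReal (u i x ^ 2 * 1) ∂riemannianVolume g ≠ ⊤ :=
  ((((S.contMDiff i).continuous.pow 2).mul continuous_const).integrable_of_hasCompactSupport
    (HasCompactSupport.of_compactSpace _)).lintegral_lt_top.ne

lemma exists_eigenvalue_one_concentratedDensity_le :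
    ∃ C : ℝ≥0∞, C ≠ ⊤ ∧ ∀ δ > 0, eigenvalue g k (fun _ ↦ 1) (concentratedDensity g q δ) ≤
      ENNReal.ofReal (δ / concentratedMean g k δ * ε) * C := by
  refine ⟨∑ i, (∫⁻ x, ENNReal.ofReal (u i x ^ 2 * 1) ∂riemannianVolume g)⁻¹,
    ENNReal.sum_ne_top.2 fun i _ ↦ ENNReal.inv_ne_top.2 (S.lintegral_sq_ne_zero i),
    fun δ hδ ↦ ?_⟩
  refine eigenvalue_le_of_disjoint_tsupport g S.contMDiff S.disjoint S.measurable S.nonneg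
    S.sq_differential_le (fun i ↦ (S.lintegral_le i).trans_lt ENNReal.ofReal_lt_top)
    measurable_const (fun _ ↦ zero_le_one)
    (S.contMDiff_concentratedDensity δ).continuous.measurable
    (fun x ↦ (S.concentratedDensity_pos hδ x).le) S.lintegral_sq_ne_zero fun i ↦ ?_
  have h1 := S.lintegral_mul_concentratedDensity_rpow_le hδ i 1
  simp only [Real.rpow_one] at h1
  refine h1.trans ?_
  rw [mul_assoc]
  refine le_mul_of_one_le_right' ?_
  rw [← ENNReal.inv_mul_cancel (S.lintegral_sq_ne_zero i) (S.lintegral_sq_ne_top i)]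
  gcongr
  exact Finset.single_le_sum (f := fun i ↦
    (∫⁻ x, ENNReal.ofReal (u i x ^ 2 * 1) ∂riemannianVolume g)⁻¹) (fun _ _ ↦ zero_le)
    (Finset.mem_univ i)

end IsPlateauSystem

end

end WeightedLaplacian

end

open WeightedLaplacian in
/-- `M` is a compact Riemannian manifold of dimension `n ≥ 2`, possibly with boundary. -/
theorem theorem3p1 {n : ℕ} (hn : 2 ≤ n) {H : Type*} [TopologicalSpace H]
    (I : ModelWithCorners ℝ (EuclideanSpace ℝ (Fin n)) H)
    {M : Type*} [TopologicalSpace M] [ChartedSpace H M] [IsManifold I ∞ M]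
    [T2Space M] [CompactSpace M] [Nonempty M] [MeasurableSpace M] [BorelSpace M]
    (g : Bundle.ContMDiffRiemannianMetric I ∞ (EuclideanSpace ℝ (Fin n))
      (fun x : M ↦ TangentSpace I x))
    (k : ℕ) (hk : 0 < k) (p : ℝ) (hp : 0 < p) :
    (⨅ ρ ∈ normalizedDensities g, eigenvalue g k ρ (fun _ ↦ 1)) = 0 ∧
    (⨅ σ ∈ normalizedDensities g, eigenvalue g k (fun _ ↦ 1) σ) = 0 ∧
    (⨅ ρ ∈ normalizedDensities g, eigenvalue g k ρ (fun x ↦ ρ x ^ p)) = 0 := by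
  obtain ⟨u, h, q, S⟩ := exists_isPlateauSystem g hn k one_pos
  have ha : 0 < (k + 1) / (riemannianVolume g).real univ := div_pos (by positivity) S.volume_pos
  have hmean : ContinuousAt (concentratedMean g k) 0 := by unfold concentratedMean; fun_prop
  have hmean0 : concentratedMean g k 0 ≠ 0 := by simpa [concentratedMean] using ha.ne'
  have hratio : ContinuousAt (fun δ ↦ δ / concentratedMean g k δ) 0 :=
    continuousAt_id.div hmean hmean0
  refine ⟨?_, ?_, ?_⟩ <;> rw [← nonpos_iff_eq_zero]
  · have hlim : Filter.Tendsto (fun ε ↦ ENNReal.ofReal (ε * concentratedMean g k 1))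
        (nhdsWithin 0 (Ioi 0)) (nhds 0) := by
      have : ContinuousAt (fun ε ↦ ENNReal.ofReal (ε * concentratedMean g k 1)) 0 :=
        (ENNReal.continuous_ofReal.comp (continuous_id.mul continuous_const)).continuousAt
      simpa using this.continuousWithinAt.tendsto
    refine ge_of_tendsto hlim (Filter.eventually_of_mem self_mem_nhdsWithin fun ε hε ↦ ?_)
    obtain ⟨u, h, q, S⟩ := exists_isPlateauSystem g hn k hε
    have := S.eigenvalue_concentratedDensity_rpow_le one_pos 0
    simp only [Real.rpow_zero, one_mul] at this
    exact (iInf₂_le _ (S.concentratedDensity_mem one_pos)).trans this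
  · obtain ⟨C, hC, hle⟩ := S.exists_eigenvalue_one_concentratedDensity_le
    have hlim : Filter.Tendsto (fun δ ↦ ENNReal.ofReal (δ / concentratedMean g k δ * 1) * C)
        (nhdsWithin 0 (Ioi 0)) (nhds 0) := by
      have h1 := ENNReal.tendsto_ofReal (hratio.mul_const 1).continuousWithinAt.tendsto
        (f := nhdsWithin 0 (Ioi 0))
      have h2 := ENNReal.Tendsto.mul_const h1 (Or.inr hC)
      simpa using h2
    refine ge_of_tendsto hlim (Filter.eventually_of_mem self_mem_nhdsWithin fun δ hδ ↦ ?_)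
    exact (iInf₂_le _ (S.concentratedDensity_mem hδ)).trans (hle δ hδ)
  · have hlim : Filter.Tendsto (fun δ ↦ ENNReal.ofReal
        ((δ / concentratedMean g k δ) ^ p * 1 * concentratedMean g k δ))
        (nhdsWithin 0 (Ioi 0)) (nhds 0) := by
      have h1 := (((hratio.rpow_const (p := p) (Or.inr hp.le)).mul_const 1).mul
        hmean).continuousWithinAt (s := Ioi 0)
      simpa [hp.ne'] using ENNReal.tendsto_ofReal h1.tendsto
    refine ge_of_tendsto hlim (Filter.eventually_of_mem self_mem_nhdsWithin fun δ hδ ↦ ?_)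
    exact (iInf₂_le _ (S.concentratedDensity_mem hδ)).trans
      (S.eigenvalue_concentratedDensity_rpow_le hδ p)
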